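/- There is an absolute constant $C>0$ such that the following holds. Let $k\in\{1,2\}$ and let $A=(a_{ij})\in\mathbb{R}^{m\times n}$ be a random matrix with (mutually) independent, not necessarily identically distributed entries, all of which are sub-exponential if $k=1$ and sub-gaussian if $k=2$, that is, $$\|a_{ij}\|_{\psi_k}:=\inf\left\{t>0:\ \mathbb{E}\exp\left(|a_{ij}|^k/t^k\right)\le 2\right\}<\infty .$$ Suppose that $A$ is $2$-central, i.e. all entries have the same variance, and that this variance is positive. Set $$\mu_p(A):=\max_{i,j}\left|\mathbb{E}\{(a_{ij}-\mathbb{E}a_{ij})^p\}\right|,\qquad K(A):=\mu_2(A)^2+\mu_3(A)+\mu_2(A)\mu_3(A)+\mu_4(A),\qquad \|A\|_{\psi_k}:=\max_{i,j}\|a_{ij}\|_{\psi_k}.$$ Let $\rho\in(0,1)$, $\tau>0$ and $s\in\{1,\dots,n\}$, and suppose that $$m\ \ge\ C\left(\frac{K(A)}{\mu_2(A)^{5/2}\,\tau}\left(1+\tau\rho^{-1}\|A\|_{\psi_k}\sqrt{s\log n}\right)\right)^2 .$$ Then, with probability at least $1-\exp\left(-\frac{\mu_2(A)^4}{K(A)^2}\cdot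 m\right)$, the matrix $A$ satisfies the $\ell_2$-robust null space property $\ell_2\text{-}\mathrm{RNSP}(s,\rho,\tau)$, that is, $$\|\boldsymbol{v}_S\|_2\ \le\ \frac{\rho}{\sqrt{s}}\,\|\boldsymbol{v}_{\bar S}\|_1+\tau\|A\boldsymbol{v}\|_2$$ holds for every $\boldsymbol{v}\in\mathbb{R}^n$ and every $S\subseteq\{1,\dots,n\}$ with $|S|\le s$, where $\bar S$ is the complement of $S$ and $\boldsymbol{v}_S$ agrees with $\boldsymbol{v}$ on $S$ and vanishes elsewhere. -/

import Mathlib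

open MeasureTheory ProbabilityTheory

/-- The admissible scales in the definition of the `ψ_k`-norm of a random variable `X`:
all `t > 0` with `E exp(|X|^k / t^k) ≤ 2`. The expectation of this positive function is taken
as a lower Lebesgue integral, so that an infinite expectation is not admissible. -/
def psiScales {Ω : Type*} [MeasurableSpace Ω] (k : ℕ) (X : Ω → ℝ) (P : Measure Ω) : Set ℝ :=
  {t : ℝ | 0 < t ∧ ∫⁻ ω, ENNReal.ofReal (Real.exp (|X ω| ^ k / t ^ k)) ∂P ≤ 2}

/-- `X` has a finite `ψ_k`-norm: sub-exponential for `k = 1`, sub-gaussian for `k = 2`. -/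
def HasFinitePsiNorm {Ω : Type*} [MeasurableSpace Ω] (k : ℕ) (X : Ω → ℝ) (P : Measure Ω) :
    Prop :=
  (psiScales k X P).Nonempty

/-- The `ψ_k`-norm: the sub-exponential norm for `k = 1`, the sub-gaussian norm for `k = 2`. -/
noncomputable def psiNorm {Ω : Type*} [MeasurableSpace Ω] (k : ℕ) (X : Ω → ℝ) (P : Measure Ω) :
    ℝ :=
  sInf (psiScales k X P)

/-- `‖A‖_{ψ_k}`: the largest `ψ_k`-norm of an entry. -/
noncomputable def matrixPsiNorm {Ω : Type*} [MeasurableSpace Ω] {m n : ℕ} (k : ℕ)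
    (A : Ω → Matrix (Fin m) (Fin n) ℝ) (P : Measure Ω) : ℝ :=
  ⨆ e : Fin m × Fin n, psiNorm k (fun ω => A ω e.1 e.2) P

/-- `A` is `k`-central: for each `1 ≤ p ≤ k`, all entries have the same `p`-th central moment. -/
def IsCentral {Ω : Type*} [MeasurableSpace Ω] {m n : ℕ} (k : ℕ)
    (A : Ω → Matrix (Fin m) (Fin n) ℝ) (P : Measure Ω) : Prop :=
  ∀ p : ℕ, 1 ≤ p → p ≤ k → ∀ (i i' : Fin m) (j j' : Fin n),
    centralMoment (fun ω => A ω i j) p P = centralMoment (fun ω => A ω i' j') p P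

/-- `μ_p(A)`: the largest absolute value of the `p`-th central moment of an entry. -/
noncomputable def matrixCentralMoment {Ω : Type*} [MeasurableSpace Ω] {m n : ℕ} (p : ℕ)
    (A : Ω → Matrix (Fin m) (Fin n) ℝ) (P : Measure Ω) : ℝ :=
  ⨆ e : Fin m × Fin n, |centralMoment (fun ω => A ω e.1 e.2) p P|

/-- `K(A) = μ₂(A)² + μ₃(A) + μ₂(A) μ₃(A) + μ₄(A)`. -/
noncomputable def momentK {Ω : Type*} [MeasurableSpace Ω] {m n : ℕ}
    (A : Ω → Matrix (Fin m) (Fin n) ℝ) (P : Measure Ω) : ℝ :=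
  matrixCentralMoment 2 A P ^ 2 + matrixCentralMoment 3 A P
    + matrixCentralMoment 2 A P * matrixCentralMoment 3 A P + matrixCentralMoment 4 A P

/-- The `ℓ₂`-robust null space property of order `s` with parameters `ρ` and `τ`:
`‖v_S‖₂ ≤ (ρ / √s) ‖v_{Sᶜ}‖₁ + τ ‖M v‖₂` for every vector `v` and every `S` of size at most `s`. -/
def SatisfiesRNSP {m n : ℕ} (M : Matrix (Fin m) (Fin n) ℝ) (s : ℕ) (ρ τ : ℝ) : Prop :=
  ∀ S : Finset (Fin n), S.card ≤ s → ∀ v : Fin n → ℝ,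
    Real.sqrt (∑ j ∈ S, v j ^ 2) ≤
      ρ / Real.sqrt s * ∑ j ∈ Sᶜ, |v j| + τ * Real.sqrt (∑ i, (M.mulVec v) i ^ 2)

/-! Write `v` for the common variance, `K` for `momentK` and `r = v^2 / K`, so that `r ≤ 1/2`. A
vector violating the null space inequality has, after normalization in `ℓ₂`, `ℓ₁`-norm at most
`2√s/ρ`. Hence it suffices to bound `‖Ax‖₂` below by `1/τ` on unit vectors of that kind
(`satisfiesRNSP_of_lower_bound`). This is a small-ball argument: an anti-concentration bound for
each row, a bound on the empirical process, and concentration.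

Small ball: by Paley–Zygmund each `⟨row, x⟩` exceeds `√v/10` in absolute value with probability at
least `q = 0.65 r`, whatever the means of the entries (`smallBall_of_iIndepFun`). The mean only adds
a shift `b`, and the ratio of fourth moment to squared second moment stays below `3/(2r)` uniformly
in `b`.

Pairing: the claimed failure probability is `exp(-r^2 m)` with constant exactly one. McDiarmid over
single rows would give at best `exp(-2 q^2 m) = exp(-0.845 r^2 m)`. Rows are therefore grouped into
`M = ⌊m/2⌋` pairs. A pair responds when either row is large, with probability at least `q(2 - q) ≥
1.08 r`. A deviation of `1.05 r` per pair is then affordable, and `2 M (1.05 r)^2` exceeds `m r^2`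
once `M` is not tiny.

Empirical process: the response, truncated at one, is Lipschitz in the two row products.
Symmetrization and contraction, pair by pair, replace it by a linear process `⟨w, x⟩`, where `w` is
a randomly signed sum of rows (`LinearlyDominated`). Its supremum is at most `‖x‖₁ ‖w‖_∞`. The signs
make centering unnecessary, and `E cosh(cX) ≤ exp((ct)^2)` for `|ct| ≤ 1` holds for both `k = 1` and
`k = 2`. A scale `c` of order `√(log n / m)/ψ` is small enough for this bound, so sub-exponential
entries also cost only `√(s log n)`.

All estimates are made for finite sets of points and passed to the whole set by continuity. For `n =
1` the row condition contains no logarithm and `m` may be small; there a direct Chernoff bound for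
one vector is enough. -/

section BoundedDifferences

/-! ### McDiarmid's inequality on a finite product space. -/

lemma measurePreserving_cons {X : Type*} [MeasurableSpace X] {M : ℕ} (ν : Fin (M + 1) → Measure X)
    [∀ i, IsProbabilityMeasure (ν i)] :
    MeasurePreserving (fun p : X × (Fin M → X) => (Fin.cons p.1 p.2 : Fin (M + 1) → X))
      ((ν 0).prod (Measure.pi fun i => ν i.succ)) (Measure.pi ν) := by
  have h := (measurePreserving_piFinSuccAbove ν 0).symm
  convert h using 1
  · ext p j
    refine Fin.cases ?_ (fun j => ?_) j <;>
      simp [MeasurableEquiv.piFinSuccAbove_symm_apply, Fin.insertNthEquiv]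
  · simp only [Fin.zero_succAbove]

lemma integral_pi_cons {X : Type*} [MeasurableSpace X] {M : ℕ} (ν : Fin (M + 1) → Measure X)
    [∀ i, IsProbabilityMeasure (ν i)] {f : (Fin (M + 1) → X) → ℝ}
    (hf : Measurable f) :
    ∫ z, f z ∂(Measure.pi ν) = ∫ p : X × (Fin M → X), f (Fin.cons p.1 p.2)
      ∂((ν 0).prod (Measure.pi fun i => ν i.succ)) := by
  rw [← (measurePreserving_cons ν).map_eq,
    integral_map (measurePreserving_cons ν).measurable.aemeasurable hf.aestronglyMeasurable]

/-- Hoeffding's lemma for a function whose values differ by at most one. -/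
lemma integral_exp_le_of_forall_sub_le {X : Type*} [MeasurableSpace X] (ν : Measure X)
    [IsProbabilityMeasure ν] {f : X → ℝ} (hf : Measurable f)
    (hd : ∀ x y, f x - f y ≤ 1) (t : ℝ) :
    ∫ x, Real.exp (t * f x) ∂ν ≤ Real.exp (t * ∫ x, f x ∂ν + t ^ 2 / 8) := by
  have hne : Nonempty X := nonempty_of_isProbabilityMeasure ν
  obtain ⟨x₀⟩ := hne
  have hbdd : BddBelow (Set.range f) := ⟨f x₀ - 1, by rintro _ ⟨x, rfl⟩; linarith [hd x₀ x]⟩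
  have hmem : ∀ x, f x ∈ Set.Icc (⨅ y, f y) ((⨅ y, f y) + 1) := by
    intro x
    refine ⟨ciInf_le hbdd x, ?_⟩
    have : f x - 1 ≤ ⨅ y, f y := by
      have : Nonempty X := ⟨x₀⟩
      exact le_ciInf fun y => by linarith [hd x y]
    linarith
  have h := (hasSubgaussianMGF_of_mem_Icc (μ := ν) hf.aemeasurable
    (Filter.Eventually.of_forall hmem)).mgf_le t
  have h2 : mgf (fun x => f x - ∫ x, f x ∂ν) ν t
      = Real.exp (-(t * ∫ x, f x ∂ν)) * ∫ x, Real.exp (t * f x) ∂ν := by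
    rw [mgf, ← integral_const_mul]
    congr 1; ext x; rw [← Real.exp_add]; ring_nf
  rw [h2] at h
  -- The variance proxy of an interval of length one is `(1/2)^2`, whence the `t^2/8`.
  have h3 : ((((‖(⨅ y, f y) + 1 - (⨅ y, f y)‖₊ / 2) ^ 2 : NNReal)) : ℝ) = 1 / 4 := by
    simp; norm_num
  rw [h3, Real.exp_neg, inv_mul_le_iff₀ (Real.exp_pos _), ← Real.exp_add] at h
  refine h.trans (Real.exp_le_exp.2 (by linarith))

/-- McDiarmid's exponential moment bound for functions with differences at most one. -/
lemma integral_exp_le_of_boundedDifferences {X : Type*} [MeasurableSpace X] {M : ℕ}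
    (ν : Fin M → Measure X) [∀ i, IsProbabilityMeasure (ν i)] {f : (Fin M → X) → ℝ}
    (hf : Measurable f) {K : ℝ} (hb : ∀ x, |f x| ≤ K)
    (hd : ∀ i x y, (∀ j, j ≠ i → x j = y j) → f x - f y ≤ 1) (t : ℝ) :
    ∫ x, Real.exp (t * f x) ∂(Measure.pi ν)
      ≤ Real.exp (t * ∫ x, f x ∂(Measure.pi ν) + M * (t ^ 2 / 8)) := by
  induction M with
  | zero =>
    have : ∀ x : Fin 0 → X, f x = f Fin.elim0 := fun x => by congr 1; exact Subsingleton.elim _ _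
    simp [this]
  | succ M ih =>
    have hfc : Measurable fun p : X × (Fin M → X) => f (Fin.cons p.1 p.2) :=
      hf.comp (measurePreserving_cons ν).measurable
    set τ := Measure.pi fun i : Fin M => ν i.succ with hτ
    have hint : ∀ {h : X × (Fin M → X) → ℝ} (C : ℝ), Measurable h → (∀ p, |h p| ≤ C) →
        Integrable h ((ν 0).prod τ) := fun C hm hC =>
      Integrable.of_bound hm.aestronglyMeasurable C (Filter.Eventually.of_forall hC)
    -- Averaging over the first coordinate preserves the bounded differences in the others, so the
    -- induction hypothesis applies to `g`, and Hoeffding's lemma handles the first coordinate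
    -- conditionally.
    set g : (Fin M → X) → ℝ := fun y => ∫ x, f (Fin.cons x y) ∂(ν 0) with hg
    have hgm : Measurable g := by
      have : StronglyMeasurable fun q : (Fin M → X) × X => f (Fin.cons q.2 q.1) :=
        (hfc.comp measurable_swap).stronglyMeasurable
      exact this.integral_prod_right.measurable
    have hsec : ∀ y, Measurable fun x => f (Fin.cons x y) := fun y =>
      hfc.comp (measurable_id.prodMk measurable_const)
    have hseci : ∀ y, Integrable (fun x => f (Fin.cons x y)) (ν 0) := fun y =>
      Integrable.of_bound (hsec y).aestronglyMeasurable K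
        (Filter.Eventually.of_forall fun x => hb _)
    have hgb : ∀ y, |g y| ≤ K := by
      intro y
      have := norm_integral_le_of_norm_le_const (μ := ν 0) (f := fun x => f (Fin.cons x y))
        (C := K) (Filter.Eventually.of_forall fun x => hb _)
      simpa using this
    have hgd : ∀ i x y, (∀ j, j ≠ i → x j = y j) → g x - g y ≤ 1 := by
      intro i x y hxy
      rw [hg]
      simp only
      rw [← integral_sub (hseci x) (hseci y)]
      have : ∫ z, (f (Fin.cons z x) - f (Fin.cons z y)) ∂(ν 0) ≤ ∫ _z, (1 : ℝ) ∂(ν 0) := by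
        refine integral_mono ((hseci x).sub (hseci y)) (integrable_const _) fun z => ?_
        refine hd i.succ _ _ fun j hj => ?_
        refine Fin.cases ?_ (fun j => ?_) j (motive := fun j => j ≠ i.succ →
          (Fin.cons z x : Fin (M + 1) → X) j = (Fin.cons z y : Fin (M + 1) → X) j) hj
        · simp
        · intro hj
          simpa using hxy j fun h => hj (by rw [h])
      simpa using this
    have hexpb : ∀ p : X × (Fin M → X), |Real.exp (t * f (Fin.cons p.1 p.2))| ≤
        Real.exp (|t| * K) := by
      intro p
      rw [abs_of_pos (Real.exp_pos _)]
      refine Real.exp_le_exp.2 ((le_abs_self _).trans ?_)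
      rw [abs_mul]
      exact mul_le_mul_of_nonneg_left (hb _) (abs_nonneg _)
    have hexpm : Measurable fun p : X × (Fin M → X) => Real.exp (t * f (Fin.cons p.1 p.2)) :=
      Real.measurable_exp.comp (hfc.const_mul t)
    have hEf : ∫ x, f x ∂(Measure.pi ν) = ∫ y, g y ∂τ := by
      rw [integral_pi_cons ν hf, integral_prod_symm _ (hint K hfc fun p => hb _)]
    have hgi : Integrable (fun y => Real.exp (t * g y + t ^ 2 / 8)) τ := by
      refine Integrable.of_bound (C := Real.exp (|t| * K + t ^ 2 / 8))
        (Real.measurable_exp.comp ((hgm.const_mul t).add_const _)).aestronglyMeasurable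
        (Filter.Eventually.of_forall fun y => ?_)
      rw [Real.norm_eq_abs, abs_of_pos (Real.exp_pos _)]
      refine Real.exp_le_exp.2 (add_le_add_left ((le_abs_self _).trans ?_) _)
      rw [abs_mul]
      exact mul_le_mul_of_nonneg_left (hgb _) (abs_nonneg _)
    rw [hEf, integral_pi_cons ν (f := fun x => Real.exp (t * f x))
        (Real.measurable_exp.comp (hf.const_mul t)),
      integral_prod_symm _ (hint _ hexpm hexpb)]
    calc ∫ y, ∫ x, Real.exp (t * f (Fin.cons x y)) ∂(ν 0) ∂τ
        ≤ ∫ y, Real.exp (t * g y + t ^ 2 / 8) ∂τ := by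
          refine integral_mono (hint _ hexpm hexpb).integral_prod_right hgi fun y => ?_
          refine integral_exp_le_of_forall_sub_le (ν 0) (hsec y) (fun a b => ?_) t
          refine hd 0 _ _ fun j hj => ?_
          obtain ⟨k, rfl⟩ := Fin.exists_succ_eq.2 hj
          simp
      _ = (∫ y, Real.exp (t * g y) ∂τ) * Real.exp (t ^ 2 / 8) := by
          rw [← integral_mul_const]
          simp only [Real.exp_add]
      _ ≤ Real.exp (t * ∫ y, g y ∂τ + M * (t ^ 2 / 8)) * Real.exp (t ^ 2 / 8) :=
          mul_le_mul_of_nonneg_right (ih (fun i => ν i.succ) hgm hgb hgd) (Real.exp_pos _).le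
      _ = _ := by rw [← Real.exp_add]; congr 1; push_cast; ring

/-- McDiarmid's inequality, lower tail. -/
lemma measureReal_le_of_boundedDifferences {X : Type*} [MeasurableSpace X] {M : ℕ}
    (hM : 0 < M) (ν : Fin M → Measure X) [∀ i, IsProbabilityMeasure (ν i)] {f : (Fin M → X) → ℝ}
    (hf : Measurable f) {K : ℝ} (hb : ∀ x, |f x| ≤ K)
    (hd : ∀ i x y, (∀ j, j ≠ i → x j = y j) → f x - f y ≤ 1) {u : ℝ} (hu : 0 ≤ u) :
    (Measure.pi ν).real {x | f x ≤ (∫ x, f x ∂(Measure.pi ν)) - M * u}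
      ≤ Real.exp (-(2 * M * u ^ 2)) := by
  have hM' : (0 : ℝ) < M := by exact_mod_cast hM
  -- The mean cancels in the Chernoff exponent, leaving `t M u + M t^2/8`, minimal at `t = -4u`.
  set t : ℝ := -(4 * u) with ht
  have hexp : Integrable (fun x => Real.exp (t * f x)) (Measure.pi ν) := by
    refine Integrable.of_bound (C := Real.exp (|t| * K))
      (Real.measurable_exp.comp (hf.const_mul t)).aestronglyMeasurable
      (Filter.Eventually.of_forall fun x => ?_)
    rw [Real.norm_eq_abs, abs_of_pos (Real.exp_pos _)]
    refine Real.exp_le_exp.2 ((le_abs_self _).trans ?_)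
    rw [abs_mul]
    exact mul_le_mul_of_nonneg_left (hb _) (abs_nonneg _)
  refine (measure_le_le_exp_mul_mgf (X := f) (μ := Measure.pi ν) _ (by rw [ht]; linarith)
    hexp).trans ?_
  refine (mul_le_mul_of_nonneg_left (integral_exp_le_of_boundedDifferences ν hf hb hd t)
    (Real.exp_pos _).le).trans ?_
  rw [← Real.exp_add]
  refine Real.exp_le_exp.2 (le_of_eq ?_)
  rw [ht]; ring

end BoundedDifferences

/-! ### Maxima of finite processes: symmetrization and contraction. -/

section FiniteMaximum

/-- The maximum of a real function on a nonempty finite type. -/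
noncomputable def finMax {T : Type*} [Fintype T] [Nonempty T] (f : T → ℝ) : ℝ :=
  Finset.univ.sup' Finset.univ_nonempty f

variable {T : Type*} [Fintype T] [Nonempty T]

lemma le_finMax (f : T → ℝ) (t : T) : f t ≤ finMax f :=
  Finset.le_sup' f (Finset.mem_univ t)

lemma exists_eq_finMax (f : T → ℝ) : ∃ t, finMax f = f t := by
  obtain ⟨t, -, ht⟩ := Finset.exists_mem_eq_sup' Finset.univ_nonempty f
  exact ⟨t, ht⟩

lemma finMax_le {f : T → ℝ} {c : ℝ} (h : ∀ t, f t ≤ c) : finMax f ≤ c :=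
  Finset.sup'_le _ _ fun t _ => h t

lemma measurable_finMax {X : Type*} [MeasurableSpace X] {f : X → T → ℝ}
    (hf : ∀ t, Measurable fun x => f x t) : Measurable fun x => finMax (f x) := by
  have := Finset.measurable_sup' (s := (Finset.univ : Finset T)) Finset.univ_nonempty
    (f := fun t x => f x t) (fun t _ => hf t)
  convert this using 1
  ext x
  simp [finMax, Finset.sup'_apply]

lemma abs_finMax_le (f : T → ℝ) : |finMax f| ≤ ∑ t, |f t| := by
  obtain ⟨t, ht⟩ := exists_eq_finMax f
  rw [ht]
  exact Finset.single_le_sum (f := fun t => |f t|) (fun t _ => abs_nonneg _) (Finset.mem_univ t)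

lemma integrable_finMax {X : Type*} [MeasurableSpace X] {μ : Measure X} {f : X → T → ℝ}
    (hm : ∀ t, Measurable fun x => f x t) (hf : ∀ t, Integrable (fun x => f x t) μ) :
    Integrable (fun x => finMax (f x)) μ := by
  refine Integrable.mono' (integrable_finsetSum (Finset.univ : Finset T) fun t _ => (hf t).abs)
    (measurable_finMax hm).aestronglyMeasurable (Filter.Eventually.of_forall fun x => ?_)
  simpa using abs_finMax_le (f x)

/-- Two-dimensional contraction: a function that is `1`-Lipschitz in a pair of directions may be
replaced by the two directions with random signs. -/
lemma finMax_add_finMax_le_of_contraction (A Φ g h : T → ℝ)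
    (hΦ : ∀ t t', 2 * (Φ t - Φ t') ≤ |g t - g t'| + |h t - h t'|) :
    finMax (fun t => A t + 2 * Φ t) + finMax (fun t => A t - 2 * Φ t) ≤
      (1 / 2) * ((finMax (fun t => A t + 2 * g t) + finMax (fun t => A t - 2 * g t))
        + (finMax (fun t => A t + 2 * h t) + finMax (fun t => A t - 2 * h t))) := by
  -- Testing the two maxima at `t, t'` in either order yields the absolute value; this is where the
  -- random sign is used.
  have key : ∀ (k : T → ℝ) t t', A t + A t' + 2 * |k t - k t'| ≤
      finMax (fun t => A t + 2 * k t) + finMax (fun t => A t - 2 * k t) := by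
    intro k t t'
    have h1 : A t + 2 * k t ≤ _ := le_finMax (fun t => A t + 2 * k t) t
    have h2 : A t' - 2 * k t' ≤ _ := le_finMax (fun t => A t - 2 * k t) t'
    have h3 : A t' + 2 * k t' ≤ _ := le_finMax (fun t => A t + 2 * k t) t'
    have h4 : A t - 2 * k t ≤ _ := le_finMax (fun t => A t - 2 * k t) t
    rcases abs_cases (k t - k t') with ⟨h, -⟩ | ⟨h, -⟩ <;> rw [h] <;> linarith
  obtain ⟨t, ht⟩ := exists_eq_finMax (fun t => A t + 2 * Φ t)
  obtain ⟨t', ht'⟩ := exists_eq_finMax (fun t => A t - 2 * Φ t)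
  rw [ht, ht']
  linarith [hΦ t t', key g t t', key h t t']

/-- One-step symmetrization without signs. -/
lemma integral_finMax_symmetrization_le {X : Type*} [MeasurableSpace X] {ν : Measure X}
    [IsProbabilityMeasure ν] (A : T → ℝ) {Φ : X → T → ℝ} (hm : ∀ t, Measurable fun x => Φ x t)
    (hΦ : ∀ t, Integrable (fun x => Φ x t) ν) :
    ∫ x, finMax (fun t => A t + ((∫ y, Φ y t ∂ν) - Φ x t)) ∂ν ≤
      ∫ x, (1 / 2) * (finMax (fun t => A t + 2 * Φ x t) + finMax (fun t => A t - 2 * Φ x t)) ∂ν := by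
  have hi1 : Integrable (fun x => finMax (fun t => A t + 2 * Φ x t)) ν :=
    integrable_finMax (fun t => ((hm t).const_mul 2).const_add _)
      fun t => (integrable_const _).add ((hΦ t).const_mul 2)
  have hi2 : Integrable (fun x => finMax (fun t => A t - 2 * Φ x t)) ν :=
    integrable_finMax (fun t => measurable_const.sub ((hm t).const_mul 2))
      fun t => (integrable_const _).sub ((hΦ t).const_mul 2)
  -- Jensen: the maximum is convex.
  have h1 : finMax (fun t => A t + 2 * ∫ y, Φ y t ∂ν) ≤
      ∫ x, finMax (fun t => A t + 2 * Φ x t) ∂ν := by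
    refine finMax_le fun t => ?_
    have : A t + 2 * ∫ y, Φ y t ∂ν = ∫ y, (A t + 2 * Φ y t) ∂ν := by
      rw [integral_add (integrable_const _) ((hΦ t).const_mul 2), integral_const_mul]
      simp
    rw [this]
    exact integral_mono ((integrable_const _).add ((hΦ t).const_mul 2)) hi1
      fun x => le_finMax (fun t => A t + 2 * Φ x t) t
  rw [integral_const_mul, integral_add hi1 hi2]
  -- The process is the midpoint of `A + 2 E Φ` and `A - 2 Φ`; with Jensen on the first half, no
  -- independent copy is needed.
  calc ∫ x, finMax (fun t => A t + ((∫ y, Φ y t ∂ν) - Φ x t)) ∂ν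
      ≤ ∫ x, ((1 / 2) * finMax (fun t => A t + 2 * ∫ y, Φ y t ∂ν)
          + (1 / 2) * finMax (fun t => A t - 2 * Φ x t)) ∂ν := by
        refine integral_mono (integrable_finMax
          (fun t => ((hm t).const_sub _).const_add _)
          fun t => (integrable_const _).add ((integrable_const _).sub (hΦ t)))
          ((integrable_const _).add (hi2.const_mul _)) fun x => finMax_le fun t => ?_
        have h1 : A t + 2 * ∫ y, Φ y t ∂ν ≤ _ := le_finMax (fun t => A t + 2 * ∫ y, Φ y t ∂ν) t
        have h2 : A t - 2 * Φ x t ≤ _ := le_finMax (fun t => A t - 2 * Φ x t) t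
        linarith
    _ = (1 / 2) * finMax (fun t => A t + 2 * ∫ y, Φ y t ∂ν)
          + (1 / 2) * ∫ x, finMax (fun t => A t - 2 * Φ x t) ∂ν := by
        rw [integral_add (integrable_const _) (hi2.const_mul _), integral_const,
          probReal_univ, one_smul, integral_const_mul]
    _ ≤ _ := by linarith

end FiniteMaximum

/-! ### Domination by linear processes and its behaviour under products. -/

section Domination

variable {T : Type*} [Fintype T] [Nonempty T] {n : ℕ}

/-- The finite process `ψ` under `ν` is dominated, in expected maximum after adding an arbitrary
deterministic process, by a random linear process over the points `x t`, whose random direction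
has coordinatewise exponential moments at `±e` bounded by `B`. -/
def LinearlyDominated {X : Type*} [MeasurableSpace X] (x : T → Fin n → ℝ) (e : ℝ) (B : ENNReal)
    (ν : Measure X) (ψ : X → T → ℝ) : Prop :=
  ∃ ω : Measure (Fin n → ℝ), IsProbabilityMeasure ω ∧ (∀ j, Integrable (fun w => w j) ω) ∧
    (∀ j, ∫⁻ w, ENNReal.ofReal (Real.exp (e * w j)) ∂ω ≤ B ∧
      ∫⁻ w, ENNReal.ofReal (Real.exp (-e * w j)) ∂ω ≤ B) ∧
    ∀ A : T → ℝ, ∫ y, finMax (fun t => A t + ψ y t) ∂ν ≤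
      ∫ w, finMax (fun t => A t + ∑ j, w j * x t j) ∂ω

lemma integrable_finMax_linear {ω : Measure (Fin n → ℝ)} [IsProbabilityMeasure ω]
    (hω : ∀ j, Integrable (fun w => w j) ω) (x : T → Fin n → ℝ) (A : T → ℝ) :
    Integrable (fun w : Fin n → ℝ => finMax (fun t => A t + ∑ j, w j * x t j)) ω :=
  integrable_finMax (fun t => by fun_prop) fun t => (integrable_const _).add
    (integrable_finsetSum _ fun j _ => (hω j).mul_const _)

/-- Summands are replaced one at a time. With all other terms frozen by Fubini, they play the role
of the arbitrary deterministic `A`, which is why the definition quantifies over `A`. The random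
directions add independently, so the new law is a convolution and exponential moments multiply. -/
lemma LinearlyDominated.pi {X : Type*} [MeasurableSpace X] {x : T → Fin n → ℝ} {e : ℝ}
    {B : ENNReal} {M : ℕ} (ν : Fin M → Measure X) [∀ i, IsProbabilityMeasure (ν i)]
    (ψ : Fin M → X → T → ℝ) (hm : ∀ i t, Measurable fun y => ψ i y t) {C : ℝ}
    (hC : ∀ i y t, |ψ i y t| ≤ C)
    (h : ∀ i, LinearlyDominated x e B (ν i) (ψ i)) :
    LinearlyDominated x e (B ^ M) (Measure.pi ν) (fun y t => ∑ i, ψ i (y i) t) := by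
  induction M with
  | zero =>
    refine ⟨Measure.dirac 0, inferInstance, fun j => ?_, fun j => ?_, fun A => ?_⟩
    · exact integrable_dirac (by simp)
    · simp [lintegral_dirac]
    · simp [integral_dirac]
  | succ M ih =>
    obtain ⟨ω₁, hp₁, hi₁, he₁, hd₁⟩ := h 0
    obtain ⟨ω₂, hp₂, hi₂, he₂, hd₂⟩ := ih (fun i => ν i.succ) (fun i => ψ i.succ)
      (fun i => hm i.succ) (fun i => hC i.succ) (fun i => h i.succ)
    set τ := Measure.pi fun i : Fin M => ν i.succ with hτ
    refine ⟨ω₁.conv ω₂, inferInstance, fun j => ?_, fun j => ?_, fun A => ?_⟩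
    · rw [Measure.conv, integrable_map_measure
        (f := fun x : (Fin n → ℝ) × (Fin n → ℝ) => x.1 + x.2) (g := fun w : Fin n → ℝ => w j)
        (measurable_pi_apply j).aestronglyMeasurable (by fun_prop)]
      exact ((hi₁ j).comp_fst ω₂).add ((hi₂ j).comp_snd ω₁)
    · have hexp : ∀ c : ℝ, Measurable fun w : Fin n → ℝ => ENNReal.ofReal (Real.exp (c * w j)) :=
        fun c => by fun_prop
      have key : ∀ c : ℝ, ∫⁻ w, ENNReal.ofReal (Real.exp (c * w j)) ∂(ω₁.conv ω₂)
          = (∫⁻ w, ENNReal.ofReal (Real.exp (c * w j)) ∂ω₁)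
            * ∫⁻ w, ENNReal.ofReal (Real.exp (c * w j)) ∂ω₂ := by
        intro c
        rw [Measure.conv, lintegral_map (by fun_prop) (by fun_prop),
          ← lintegral_prod_mul (hexp c).aemeasurable (hexp c).aemeasurable]
        refine lintegral_congr fun w => ?_
        rw [← ENNReal.ofReal_mul (Real.exp_pos _).le, ← Real.exp_add]
        congr 2
        simp [mul_add]
      rw [key, key, pow_succ']
      exact ⟨mul_le_mul' (he₁ j).1 (he₂ j).1, mul_le_mul' (he₁ j).2 (he₂ j).2⟩
    · have hmt : ∀ t, Measurable fun y : Fin M → X => ∑ i, ψ i.succ (y i) t := fun t =>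
        Finset.measurable_sum _ fun i _ => (hm i.succ t).comp (measurable_pi_apply i)
      have hbt : ∀ t (y : Fin M → X), |∑ i, ψ i.succ (y i) t| ≤ M * C := fun t y => by
        refine (Finset.abs_sum_le_sum_abs _ _).trans
          ((Finset.sum_le_sum fun i _ => hC i.succ (y i) t).trans ?_)
        simp
      have hintψ : ∀ t, Integrable (fun y => ψ 0 y t) (ν 0) := fun t =>
        Integrable.of_bound (hm 0 t).aestronglyMeasurable C
          (Filter.Eventually.of_forall fun y => hC 0 y t)
      have hintS : ∀ t, Integrable (fun y => ∑ i, ψ i.succ (y i) t) τ := fun t =>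
        Integrable.of_bound (hmt t).aestronglyMeasurable (M * C)
          (Filter.Eventually.of_forall fun y => hbt t y)
      have hL : ∀ t (μ : Measure (Fin n → ℝ)), (∀ j, Integrable (fun w => w j) μ) →
          Integrable (fun w : Fin n → ℝ => ∑ j, w j * x t j) μ := fun t μ hμ =>
        integrable_finsetSum _ fun j _ => (hμ j).mul_const _
      have hmeas : Measurable fun y : Fin (M + 1) → X =>
          finMax (fun t => A t + ∑ i, ψ i (y i) t) :=
        measurable_finMax fun t => (Finset.measurable_sum _ fun i _ =>
          (hm i t).comp (measurable_pi_apply i)).const_add _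
      have hI1 : Integrable (fun p : X × (Fin M → X) =>
          finMax (fun t => A t + (ψ 0 p.1 t + ∑ i, ψ i.succ (p.2 i) t))) ((ν 0).prod τ) :=
        integrable_finMax (fun t => (((hm 0 t).comp measurable_fst).add
          ((hmt t).comp measurable_snd)).const_add _)
          fun t => (integrable_const _).add
            (((hintψ t).comp_fst τ).add ((hintS t).comp_snd (ν 0)))
      have hI2 : Integrable (fun p : X × (Fin n → ℝ) =>
          finMax (fun t => A t + ψ 0 p.1 t + ∑ j, p.2 j * x t j)) ((ν 0).prod ω₂) :=
        integrable_finMax (fun t => (((hm 0 t).comp measurable_fst).const_add _).add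
          (by fun_prop))
          fun t => ((integrable_const _).add ((hintψ t).comp_fst ω₂)).add
            ((hL t ω₂ hi₂).comp_snd (ν 0))
      have hI3 : Integrable (fun p : (Fin n → ℝ) × (Fin n → ℝ) =>
          finMax (fun t => A t + ∑ j, p.2 j * x t j + ∑ j, p.1 j * x t j)) (ω₁.prod ω₂) :=
        integrable_finMax (fun t => by fun_prop)
          fun t => ((integrable_const _).add ((hL t ω₂ hi₂).comp_snd ω₁)).add
            ((hL t ω₁ hi₁).comp_fst ω₂)
      calc ∫ y, finMax (fun t => A t + ∑ i, ψ i (y i) t) ∂(Measure.pi ν)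
          = ∫ p : X × (Fin M → X), finMax (fun t => A t + (ψ 0 p.1 t
              + ∑ i, ψ i.succ (p.2 i) t)) ∂((ν 0).prod τ) := by
            rw [integral_pi_cons ν hmeas]
            simp [Fin.sum_univ_succ, hτ]
        _ = ∫ y, ∫ z, finMax (fun t => (A t + ψ 0 y t) + ∑ i, ψ i.succ (z i) t) ∂τ ∂(ν 0) := by
            rw [integral_prod _ hI1]
            simp only [add_assoc]
        _ ≤ ∫ y, ∫ w, finMax (fun t => A t + ψ 0 y t + ∑ j, w j * x t j) ∂ω₂ ∂(ν 0) := by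
            refine integral_mono ?_ hI2.integral_prod_left fun y => hd₂ _
            have := hI1.integral_prod_left
            simpa only [add_assoc] using this
        _ = ∫ w, ∫ y, finMax (fun t => (A t + ∑ j, w j * x t j) + ψ 0 y t) ∂(ν 0) ∂ω₂ := by
            rw [integral_integral_swap hI2]
            simp only [add_right_comm]
        _ ≤ ∫ w, ∫ v, finMax (fun t => A t + ∑ j, w j * x t j + ∑ j, v j * x t j) ∂ω₁ ∂ω₂ := by
            refine integral_mono ?_ hI3.integral_prod_right fun w => hd₁ _
            have := hI2.integral_prod_right
            simpa only [add_right_comm] using this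
        _ = ∫ w, finMax (fun t => A t + ∑ j, w j * x t j) ∂(ω₁.conv ω₂) := by
            rw [← integral_prod_symm _ hI3, Measure.conv,
              integral_map (by fun_prop) (measurable_finMax fun t => by
                fun_prop).aestronglyMeasurable]
            refine integral_congr_ae (Filter.Eventually.of_forall fun p => ?_)
            simp only [Pi.add_apply, add_mul, Finset.sum_add_distrib]
            congr 1
            ext t
            ring

end Domination

/-! ### The truncated response of a pair of rows and its linear domination. -/

section PairResponse

variable {n : ℕ}

/-- The response of a pair of rows to the vector `x`, truncated at one. -/
noncomputable def pairResponse (η : ℝ) (y : (Fin n → ℝ) × (Fin n → ℝ)) (x : Fin n → ℝ) : ℝ :=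
  min 1 (max |∑ j, y.1 j * x j| |∑ j, y.2 j * x j| / η)

lemma pairResponse_nonneg {η : ℝ} (hη : 0 < η) (y : (Fin n → ℝ) × (Fin n → ℝ)) (x : Fin n → ℝ) :
    0 ≤ pairResponse η y x :=
  le_min zero_le_one (div_nonneg (le_max_of_le_left (abs_nonneg _)) hη.le)

lemma pairResponse_le_one (η : ℝ) (y : (Fin n → ℝ) × (Fin n → ℝ)) (x : Fin n → ℝ) :
    pairResponse η y x ≤ 1 := min_le_left _ _

lemma measurable_pairResponse (η : ℝ) (x : Fin n → ℝ) :
    Measurable fun y : (Fin n → ℝ) × (Fin n → ℝ) => pairResponse η y x := by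
  unfold pairResponse
  fun_prop

lemma integrable_pairResponse {η : ℝ} (hη : 0 < η) (x : Fin n → ℝ)
    (ν : Measure ((Fin n → ℝ) × (Fin n → ℝ))) [IsProbabilityMeasure ν] :
    Integrable (fun y => pairResponse η y x) ν :=
  Integrable.of_bound (measurable_pairResponse η x).aestronglyMeasurable 1
    (Filter.Eventually.of_forall fun y => by
      rw [Real.norm_eq_abs, abs_of_nonneg (pairResponse_nonneg hη y x)]
      exact pairResponse_le_one η y x)

/-- The sup norm on the plane is 1-Lipschitz for itself, and `2 max(|a|,|b|) = |a + b| + |a - b|`.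
The right side thus involves only absolute values of linear forms, as contraction requires. -/
lemma two_mul_max_abs_sub_le (p q p' q' : ℝ) :
    2 * (max |p| |q| - max |p'| |q'|) ≤
      |(p + q) - (p' + q')| + |(p - q) - (p' - q')| := by
  have h1 := le_abs_self ((p + q) - (p' + q'))
  have h2 := neg_le_abs ((p + q) - (p' + q'))
  have h3 := le_abs_self ((p - q) - (p' - q'))
  have h4 := neg_le_abs ((p - q) - (p' - q'))
  have h5 := le_max_left |p'| |q'|
  have h6 := le_max_right |p'| |q'|
  have h7 := le_abs_self p'
  have h8 := neg_le_abs p'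
  have h9 := le_abs_self q'
  have h10 := neg_le_abs q'
  rcases max_cases |p| |q| with ⟨h, -⟩ | ⟨h, -⟩ <;> rw [h]
  · rcases abs_cases p with ⟨h, -⟩ | ⟨h, -⟩ <;> rw [h] <;> linarith
  · rcases abs_cases q with ⟨h, -⟩ | ⟨h, -⟩ <;> rw [h] <;> linarith

/-- Truncation at one can only shrink a positive difference. -/
lemma two_mul_pairResponse_sub_le {η : ℝ} (hη : 0 < η) (y : (Fin n → ℝ) × (Fin n → ℝ))
    (x x' : Fin n → ℝ) :
    2 * (pairResponse η y x - pairResponse η y x') ≤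
      |(∑ j, y.1 j * x j + ∑ j, y.2 j * x j) / η
        - (∑ j, y.1 j * x' j + ∑ j, y.2 j * x' j) / η|
      + |(∑ j, y.1 j * x j - ∑ j, y.2 j * x j) / η
        - (∑ j, y.1 j * x' j - ∑ j, y.2 j * x' j) / η| := by
  have h := two_mul_max_abs_sub_le (∑ j, y.1 j * x j) (∑ j, y.2 j * x j)
    (∑ j, y.1 j * x' j) (∑ j, y.2 j * x' j)
  rw [← sub_div, ← sub_div, abs_div, abs_div, abs_of_pos hη, ← add_div]
  have h' := div_le_div_of_nonneg_right h hη.le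
  rw [mul_div_assoc, sub_div] at h'
  refine le_trans ?_ (max_le h' (by positivity : (0 : ℝ) ≤ _))
  unfold pairResponse
  set a := max |∑ j, y.1 j * x j| |∑ j, y.2 j * x j| / η
  set b := max |∑ j, y.1 j * x' j| |∑ j, y.2 j * x' j| / η
  rcases le_total b 1 with hb | hb
  · rw [min_eq_right hb]
    exact le_max_of_le_left (by linarith [min_le_right 1 a])
  · rw [min_eq_left hb]
    exact le_max_of_le_right (by linarith [min_le_left 1 a])

/-- After symmetrization and contraction the directions are `(2/η)(±(y₁ + y₂))` and `±(y₁ - y₂)`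
times the same factor, each with weight `1/4`. Together these are all four sign patterns, that is,
independent signs on the two rows, so only sums of exponential moments at `±` enter and the rows
need not be centered. -/
lemma linearlyDominated_pairResponse {T : Type*} [Fintype T] [Nonempty T] {η : ℝ} (hη : 0 < η)
    (x : T → Fin n → ℝ) (e : ℝ) (b : ENNReal) (ρ₁ ρ₂ : Measure (Fin n → ℝ))
    [IsProbabilityMeasure ρ₁] [IsProbabilityMeasure ρ₂]
    (hi₁ : ∀ j, Integrable (fun v => v j) ρ₁) (hi₂ : ∀ j, Integrable (fun v => v j) ρ₂)
    (hb₁ : ∀ j, ∫⁻ v, ENNReal.ofReal (Real.exp (2 * e / η * v j)) ∂ρ₁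
      + ∫⁻ v, ENNReal.ofReal (Real.exp (-(2 * e / η) * v j)) ∂ρ₁ ≤ 2 * b)
    (hb₂ : ∀ j, ∫⁻ v, ENNReal.ofReal (Real.exp (2 * e / η * v j)) ∂ρ₂
      + ∫⁻ v, ENNReal.ofReal (Real.exp (-(2 * e / η) * v j)) ∂ρ₂ ≤ 2 * b) :
    LinearlyDominated x e (b ^ 2) (ρ₁.prod ρ₂) (fun y t =>
      (∫ z, pairResponse η z (x t) ∂(ρ₁.prod ρ₂)) - pairResponse η y (x t)) := by
  set ν := ρ₁.prod ρ₂ with hν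
  set α : Fin 4 → ℝ := ![1, -1, 1, -1] with hα
  set β : Fin 4 → ℝ := ![1, -1, -1, 1] with hβ
  set W : Fin 4 → (Fin n → ℝ) × (Fin n → ℝ) → Fin n → ℝ :=
    fun k y j => 2 / η * (α k * y.1 j + β k * y.2 j) with hW
  have hWm : ∀ k, Measurable (W k) := fun k => by
    rw [hW]; fun_prop
  have hWi : ∀ k j, Integrable (fun y => W k y j) ν := fun k j =>
    ((((hi₁ j).comp_fst ρ₂).const_mul _).add (((hi₂ j).comp_snd ρ₁).const_mul _)).const_mul _
  have hexp : ∀ (c : ℝ) (j : Fin n),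
      Measurable fun w : Fin n → ℝ => ENNReal.ofReal (Real.exp (c * w j)) :=
    fun c j => by fun_prop
  have hint : ∀ (k : Fin 4) {f : (Fin n → ℝ) → ℝ}, Measurable f →
      Integrable (fun y => f (W k y)) ν → Integrable f ((4⁻¹ : ENNReal) • ν.map (W k)) := by
    intro k f hf hi
    refine Integrable.smul_measure ?_ (by simp)
    rwa [integrable_map_measure hf.aestronglyMeasurable (hWm k).aemeasurable]
  refine ⟨∑ k, (4⁻¹ : ENNReal) • ν.map (W k), ⟨?_⟩, fun j => ?_, fun j => ?_, fun A => ?_⟩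
  · have : ∀ k, (ν.map (W k)) Set.univ = 1 := fun k => by
      rw [Measure.map_apply (hWm k) MeasurableSet.univ]; simp
    simp only [Measure.coe_finsetSum, Finset.sum_apply, Measure.smul_apply, this, smul_eq_mul,
      mul_one, Finset.sum_const, Finset.card_univ, Fintype.card_fin, nsmul_eq_mul]
    exact ENNReal.mul_inv_cancel (by simp) (by simp)
  · rw [integrable_finsetSum_measure]
    exact fun k _ => hint k (measurable_pi_apply j) (hWi k j)
  · set E₁ := fun s : ℝ => ∫⁻ v, ENNReal.ofReal (Real.exp (s * (2 * e / η) * v j)) ∂ρ₁ with hE₁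
    set E₂ := fun s : ℝ => ∫⁻ v, ENNReal.ofReal (Real.exp (s * (2 * e / η) * v j)) ∂ρ₂ with hE₂
    have key : ∀ s : ℝ, ∫⁻ w, ENNReal.ofReal (Real.exp (s * e * w j))
        ∂(∑ k, (4⁻¹ : ENNReal) • ν.map (W k))
        = ∑ k, 4⁻¹ * (E₁ (s * α k) * E₂ (s * β k)) := by
      intro s
      rw [lintegral_finsetSum_measure]
      refine Finset.sum_congr rfl fun k _ => ?_
      rw [lintegral_smul_measure, lintegral_map (by fun_prop) (hWm k), hν, smul_eq_mul]
      congr 1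
      rw [hE₁, hE₂]
      simp only
      rw [← lintegral_prod_mul
        (f := fun v : Fin n → ℝ => ENNReal.ofReal (Real.exp (s * α k * (2 * e / η) * v j)))
        (g := fun v : Fin n → ℝ => ENNReal.ofReal (Real.exp (s * β k * (2 * e / η) * v j)))
        (hexp _ j).aemeasurable (hexp _ j).aemeasurable]
      refine lintegral_congr fun y => ?_
      rw [← ENNReal.ofReal_mul (Real.exp_pos _).le, ← Real.exp_add]
      congr 2
      rw [hW]
      ring
    have hs₁ : E₁ 1 + E₁ (-1) ≤ 2 * b := by simpa [hE₁] using hb₁ j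
    have hs₂ : E₂ 1 + E₂ (-1) ≤ 2 * b := by simpa [hE₂] using hb₂ j
    -- Averaging over the four sign patterns factorizes into one symmetrized moment per row.
    have hprod : 4⁻¹ * ((E₁ 1 + E₁ (-1)) * (E₂ 1 + E₂ (-1))) ≤ b ^ 2 := by
      calc 4⁻¹ * ((E₁ 1 + E₁ (-1)) * (E₂ 1 + E₂ (-1))) ≤ 4⁻¹ * ((2 * b) * (2 * b)) := by gcongr
        _ = (4⁻¹ * 4) * b ^ 2 := by ring
        _ = b ^ 2 := by rw [ENNReal.inv_mul_cancel (by simp) (by simp), one_mul]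
    have h1 := key 1
    have h2 := key (-1)
    rw [one_mul] at h1
    rw [neg_one_mul] at h2
    rw [h1, h2]
    refine ⟨le_trans (le_of_eq ?_) hprod, le_trans (le_of_eq ?_) hprod⟩ <;>
    · simp only [Fin.sum_univ_four, hα, hβ]
      simp
      ring
  · have hm : ∀ t, Measurable fun y => pairResponse η y (x t) := fun t =>
      measurable_pairResponse η (x t)
    refine (integral_finMax_symmetrization_le A hm
      fun t => integrable_pairResponse hη (x t) ν).trans ?_
    set G : Fin 4 → (Fin n → ℝ) × (Fin n → ℝ) → ℝ := fun k y =>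
      finMax (fun t => A t + ∑ j, W k y j * x t j) with hG
    have hGi : ∀ k, Integrable (G k) ν := fun k =>
      integrable_finMax (fun t => by
          have := hWm k
          fun_prop)
        fun t => (integrable_const _).add (integrable_finsetSum _ fun j _ =>
          (hWi k j).mul_const _)
    have hlin : Measurable fun w : Fin n → ℝ => finMax (fun t => A t + ∑ j, w j * x t j) :=
      measurable_finMax fun t => by fun_prop
    have hR : ∫ w, finMax (fun t => A t + ∑ j, w j * x t j)
        ∂(∑ k, (4⁻¹ : ENNReal) • ν.map (W k)) = ∫ y, ∑ k, (1 / 4) * G k y ∂ν := by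
      rw [integral_finsetSum_measure fun k _ => hint k hlin (hGi k),
        integral_finsetSum _ fun k _ => (hGi k).const_mul _]
      refine Finset.sum_congr rfl fun k _ => ?_
      rw [integral_smul_measure, integral_map (hWm k).aemeasurable hlin.aestronglyMeasurable,
        integral_const_mul]
      simp [hG]
    rw [hR]
    refine integral_mono ?_ (integrable_finsetSum _ fun k _ => (hGi k).const_mul _) fun y => ?_
    · refine Integrable.const_mul (Integrable.add ?_ ?_) _
      · exact integrable_finMax (fun t => ((hm t).const_mul 2).const_add _)
          fun t => (integrable_const _).add ((integrable_pairResponse hη (x t) ν).const_mul 2)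
      · exact integrable_finMax (fun t => measurable_const.sub ((hm t).const_mul 2))
          fun t => (integrable_const _).sub ((integrable_pairResponse hη (x t) ν).const_mul 2)
    · have h := finMax_add_finMax_le_of_contraction A (fun t => pairResponse η y (x t))
        (fun t => (∑ j, y.1 j * x t j + ∑ j, y.2 j * x t j) / η)
        (fun t => (∑ j, y.1 j * x t j - ∑ j, y.2 j * x t j) / η)
        fun t t' => two_mul_pairResponse_sub_le hη y (x t) (x t')
      have hlinear : ∀ (k : Fin 4) t, ∑ j, W k y j * x t j =
          2 * ((α k * ∑ j, y.1 j * x t j + β k * ∑ j, y.2 j * x t j) / η) := by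
        intro k t
        rw [hW, Finset.mul_sum, Finset.mul_sum, ← Finset.sum_add_distrib, Finset.sum_div,
          Finset.mul_sum]
        refine Finset.sum_congr rfl fun j _ => ?_
        ring
      have e0 : G 0 y = finMax (fun t => A t +
          2 * ((∑ j, y.1 j * x t j + ∑ j, y.2 j * x t j) / η)) := by
        rw [hG]; simp [hlinear, hα, hβ]
      have e1 : G 1 y = finMax (fun t => A t -
          2 * ((∑ j, y.1 j * x t j + ∑ j, y.2 j * x t j) / η)) := by
        rw [hG]; simp only [hlinear, hα, hβ]; congr 1; ext t; simp; ring
      have e2 : G 2 y = finMax (fun t => A t +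
          2 * ((∑ j, y.1 j * x t j - ∑ j, y.2 j * x t j) / η)) := by
        rw [hG]; simp only [hlinear, hα, hβ]; congr 1; ext t; simp; ring
      have e3 : G 3 y = finMax (fun t => A t -
          2 * ((∑ j, y.1 j * x t j - ∑ j, y.2 j * x t j) / η)) := by
        rw [hG]; simp only [hlinear, hα, hβ]; congr 1; ext t; simp; ring
      simp only [Fin.sum_univ_four, e0, e1, e2, e3]
      linarith

/-- The expected maximum of a linearly dominated process over points of bounded `ℓ₁`-norm. -/
lemma LinearlyDominated.integral_finMax_le {X : Type*} [MeasurableSpace X] {T : Type*} [Fintype T]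
    [Nonempty T] {x : T → Fin n → ℝ} {e : ℝ} {b : ℝ} {ν : Measure X} {ψ : X → T → ℝ}
    (h : LinearlyDominated x e (ENNReal.ofReal b) ν ψ) (he : 0 < e) (hb : 0 < b) (hn : 0 < n)
    {R : ℝ} (hR : ∀ t, ∑ j, |x t j| ≤ R) :
    ∫ y, finMax (ψ y) ∂ν ≤ R / e * Real.log (2 * n * b) := by
  obtain ⟨ω, hω, hi, hexp, hdom⟩ := h
  have h0 := hdom 0
  simp only [Pi.zero_apply, zero_add] at h0
  refine h0.trans ?_
  have hn' : (0 : ℝ) < n := by exact_mod_cast hn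
  have hR0 : 0 ≤ R := by
    obtain ⟨t⟩ := ‹Nonempty T›
    exact (Finset.sum_nonneg fun j _ => abs_nonneg _).trans (hR t)
  have hexpi : ∀ (c : ℝ) j, ∫⁻ w, ENNReal.ofReal (Real.exp (c * w j)) ∂ω ≤ ENNReal.ofReal b →
      Integrable (fun w : Fin n → ℝ => Real.exp (c * w j)) ω ∧
      ∫ w, Real.exp (c * w j) ∂ω ≤ b := by
    intro c j hc
    have hm : Measurable fun w : Fin n → ℝ => Real.exp (c * w j) := by fun_prop
    have hint : Integrable (fun w : Fin n → ℝ => Real.exp (c * w j)) ω := by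
      refine ⟨hm.aestronglyMeasurable, ?_⟩
      rw [hasFiniteIntegral_iff_ofReal (Filter.Eventually.of_forall fun w => (Real.exp_pos _).le)]
      exact hc.trans_lt ENNReal.ofReal_lt_top
    refine ⟨hint, ?_⟩
    rw [← ofReal_integral_eq_lintegral_ofReal hint
      (Filter.Eventually.of_forall fun w => (Real.exp_pos _).le)] at hc
    exact (ENNReal.ofReal_le_ofReal_iff hb.le).1 hc
  set S : (Fin n → ℝ) → ℝ := fun w => ∑ j, (Real.exp (e * w j) + Real.exp (-e * w j)) with hS
  have hSi : Integrable S ω := integrable_finsetSum _ fun j _ =>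
    (hexpi e j (hexp j).1).1.add (hexpi (-e) j (hexp j).2).1
  have hSle : ∫ w, S w ∂ω ≤ 2 * n * b := by
    have hsum := integral_finsetSum (μ := ω) Finset.univ
      (f := fun (j : Fin n) (w : Fin n → ℝ) => Real.exp (e * w j) + Real.exp (-e * w j))
      fun j _ => (hexpi e j (hexp j).1).1.add (hexpi (-e) j (hexp j).2).1
    refine hsum.trans_le ?_
    calc _ ≤ ∑ _j : Fin n, (b + b) := Finset.sum_le_sum fun j _ => by
          rw [integral_add (hexpi e j (hexp j).1).1 (hexpi (-e) j (hexp j).2).1]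
          exact add_le_add (hexpi e j (hexp j).1).2 (hexpi (-e) j (hexp j).2).2
      _ = 2 * n * b := by simp; ring
  set z := 2 * n * b with hz
  have hzpos : 0 < z := by positivity
  have hpt : ∀ w : Fin n → ℝ, finMax (fun t => ∑ j, w j * x t j) ≤
      R / e * (Real.log z + (S w / z - 1)) := by
    intro w
    have hSpos : ∀ j, 0 < Real.exp (e * w j) + Real.exp (-e * w j) := fun j => by positivity
    have hcoord : ∀ j, e * |w j| ≤ Real.log z + (S w / z - 1) := by
      intro j
      have h1 : Real.exp (e * |w j|) ≤ S w := by
        refine le_trans ?_ (Finset.single_le_sum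
          (f := fun j => Real.exp (e * w j) + Real.exp (-e * w j))
          (fun i _ => (hSpos i).le) (Finset.mem_univ j))
        have := Real.exp_pos (e * w j)
        have := Real.exp_pos (-e * w j)
        rcases abs_cases (w j) with ⟨h, -⟩ | ⟨h, -⟩ <;> rw [h]
        · linarith
        · rw [mul_neg, ← neg_mul]; linarith
      have hSw : 0 < S w := (Real.exp_pos _).trans_le h1
      have h2 : e * |w j| ≤ Real.log (S w) := (Real.le_log_iff_exp_le hSw).2 h1
      -- Tangent-line form of Jensen for the logarithm, at `z`, a bound for the mean of `S`; it
      -- bounds `E log S` by `log z`.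
      have h3 := Real.log_le_sub_one_of_pos (div_pos hSw hzpos)
      rw [Real.log_div hSw.ne' hzpos.ne'] at h3
      linarith
    set L := Real.log z + (S w / z - 1) with hL
    have hL0 : 0 ≤ L := (mul_nonneg he.le (abs_nonneg _)).trans (hcoord ⟨0, hn⟩)
    refine finMax_le fun t => ?_
    calc ∑ j, w j * x t j ≤ ∑ j, L / e * |x t j| := Finset.sum_le_sum fun j _ => by
          refine (le_abs_self _).trans ?_
          rw [abs_mul]
          refine mul_le_mul_of_nonneg_right ?_ (abs_nonneg _)
          rw [le_div_iff₀ he]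
          linarith [hcoord j]
      _ = L / e * ∑ j, |x t j| := by rw [Finset.mul_sum]
      _ ≤ L / e * R := mul_le_mul_of_nonneg_left (hR t) (div_nonneg hL0 he.le)
      _ = R / e * L := by ring
  have hlini : Integrable (fun w : Fin n → ℝ => finMax (fun t => ∑ j, w j * x t j)) ω := by
    simpa using integrable_finMax_linear hi x 0
  have hi2 : Integrable (fun w => S w / z - 1) ω := (hSi.div_const z).sub (integrable_const 1)
  calc ∫ w, finMax (fun t => ∑ j, w j * x t j) ∂ω
      ≤ ∫ w, R / e * (Real.log z + (S w / z - 1)) ∂ω :=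
        integral_mono hlini (((integrable_const _).add hi2).const_mul _) hpt
    _ = R / e * (Real.log z + ((∫ w, S w ∂ω) / z - 1)) := by
        rw [integral_const_mul, integral_add (integrable_const _) hi2,
          integral_sub (hSi.div_const z) (integrable_const 1), integral_div]
        simp
    _ ≤ R / e * Real.log z := by
        refine mul_le_mul_of_nonneg_left ?_ (div_nonneg hR0 he.le)
        have : (∫ w, S w ∂ω) / z ≤ 1 := (div_le_one hzpos).2 hSle
        linarith

end PairResponse

/-! ### Exponential moments and the `ψ_k`-norm. -/

section CoshMoment

/-- Termwise in the power series: every nonconstant term carries a factor `l^(2n) ≤ l^2`. -/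
lemma cosh_mul_sub_one_le {l : ℝ} (hl : |l| ≤ 1) (y : ℝ) :
    Real.cosh (l * y) - 1 ≤ l ^ 2 * (Real.cosh y - 1) := by
  have h1 := Real.hasSum_cosh (l * y)
  have h2 := (Real.hasSum_cosh y).mul_left (l ^ 2)
  -- Corrects the constant term, which scaling by `l^2` would leave at `l^2` instead of one.
  have h3 := h2.add (hasSum_ite_eq 0 (1 - l ^ 2))
  have h4 := hasSum_le (fun n => ?_) h1 h3
  · linarith
  · rcases Nat.eq_zero_or_pos n with rfl | hn
    · simp
    · rw [if_neg hn.ne', add_zero, mul_pow, mul_div_assoc]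
      have hy : 0 ≤ y ^ (2 * n) / ((2 * n).factorial : ℝ) := by
        rw [pow_mul]; positivity
      refine mul_le_mul_of_nonneg_right ?_ hy
      rw [pow_mul]
      exact pow_le_of_le_one (sq_nonneg l) ((sq_le_one_iff_abs_le_one l).2 hl) hn.ne'

lemma pow_div_factorial_le_cosh_sub_one (y : ℝ) {p : ℕ} (hp : 0 < p) :
    y ^ (2 * p) / ((2 * p).factorial : ℝ) ≤ Real.cosh y - 1 := by
  have h := sum_le_hasSum {0, p} (fun n _ => ?_) (Real.hasSum_cosh y)
  · rw [Finset.sum_pair hp.ne] at h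
    simp only [mul_zero, pow_zero, Nat.factorial_zero, Nat.cast_one, div_one] at h
    linarith
  · rw [pow_mul]; positivity

lemma cosh_le_exp_abs (y : ℝ) : Real.cosh y ≤ Real.exp |y| := by
  rw [Real.cosh_eq]
  have h1 := Real.exp_le_exp.2 (le_abs_self y)
  have h2 := Real.exp_le_exp.2 (neg_le_abs y)
  linarith

variable {Ω : Type*} [MeasurableSpace Ω] {P : Measure Ω} {X : Ω → ℝ}

/-- The hyperbolic cosine treats both values of `k` at once: `cosh y ≤ exp |y|` and `cosh y ≤ exp
(y^2/2)`. Allowing every `t ≥ t₀` avoids asking whether the infimum defining the norm is attained.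
-/
lemma lintegral_cosh_div_le_two {k : ℕ} (hk : k = 1 ∨ k = 2) {t₀ t : ℝ}
    (ht₀ : t₀ ∈ psiScales k X P) (ht : t₀ ≤ t) :
    ∫⁻ ω, ENNReal.ofReal (Real.cosh (X ω / t)) ∂P ≤ 2 := by
  obtain ⟨hpos, hle⟩ := ht₀
  refine le_trans (lintegral_mono fun ω => ENNReal.ofReal_le_ofReal ?_) hle
  have h1 : Real.cosh (X ω / t) ≤ Real.cosh (X ω / t₀) := by
    rw [Real.cosh_le_cosh, abs_div, abs_div, abs_of_pos hpos, abs_of_pos (hpos.trans_le ht)]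
    exact div_le_div_of_nonneg_left (abs_nonneg _) hpos ht
  refine h1.trans ?_
  rcases hk with rfl | rfl
  · refine (cosh_le_exp_abs _).trans (le_of_eq ?_)
    rw [abs_div, abs_of_pos hpos, pow_one, pow_one]
  · refine (Real.cosh_le_exp_half_sq _).trans (Real.exp_le_exp.2 ?_)
    rw [sq_abs, ← div_pow]
    linarith [sq_nonneg (X ω / t₀)]

lemma exists_mem_psiScales_le_of_lt {k : ℕ} (h : HasFinitePsiNorm k X P) {t : ℝ}
    (ht : psiNorm k X P < t) : ∃ t₀ ∈ psiScales k X P, t₀ ≤ t := by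
  obtain ⟨t₀, h₀, hlt⟩ := exists_lt_of_csInf_lt h ht
  exact ⟨t₀, h₀, hlt.le⟩

variable {t : ℝ}

lemma integrable_cosh_div (hX : Measurable X)
    (hc : ∫⁻ ω, ENNReal.ofReal (Real.cosh (X ω / t)) ∂P ≤ 2) :
    Integrable (fun ω => Real.cosh (X ω / t)) P := by
  refine ⟨(Real.measurable_cosh.comp (hX.div_const t)).aestronglyMeasurable, ?_⟩
  rw [hasFiniteIntegral_iff_ofReal (Filter.Eventually.of_forall fun ω => (Real.cosh_pos _).le)]
  exact hc.trans_lt (by simp)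

lemma integral_cosh_div_le (hX : Measurable X)
    (hc : ∫⁻ ω, ENNReal.ofReal (Real.cosh (X ω / t)) ∂P ≤ 2) :
    ∫ ω, Real.cosh (X ω / t) ∂P ≤ 2 := by
  rw [← ofReal_integral_eq_lintegral_ofReal (integrable_cosh_div hX hc)
    (Filter.Eventually.of_forall fun ω => (Real.cosh_pos _).le)] at hc
  have : (2 : ENNReal) = ENNReal.ofReal 2 := by simp
  rw [this] at hc
  exact (ENNReal.ofReal_le_ofReal_iff (by norm_num)).1 hc

lemma memLp_four_of_cosh (ht : 0 < t) (hX : Measurable X)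
    (hc : ∫⁻ ω, ENNReal.ofReal (Real.cosh (X ω / t)) ∂P ≤ 2) : MemLp X 4 P := by
  have h4 : Integrable (fun ω => ‖X ω‖ ^ 4) P := by
    refine Integrable.mono' ((integrable_cosh_div hX hc).const_mul (24 * t ^ 4))
      (hX.norm.pow_const 4).aestronglyMeasurable (Filter.Eventually.of_forall fun ω => ?_)
    have h := pow_div_factorial_le_cosh_sub_one (X ω / t) (p := 2) (by norm_num)
    have hf : ((2 * 2).factorial : ℝ) = 24 := by norm_num [Nat.factorial]
    rw [hf, div_pow, div_div, div_le_iff₀ (by positivity)] at h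
    have h24 : 0 < t ^ (2 * 2) * 24 := by positivity
    rw [norm_pow, norm_norm, Real.norm_eq_abs, Even.pow_abs (by decide)]
    norm_num at h
    nlinarith [pow_pos ht 4]
  have := (integrable_norm_rpow_iff (μ := P) (f := X) (p := 4) hX.aestronglyMeasurable
    (by norm_num) (by norm_num)).1 (by
      have e : ∀ x : ℝ, x ^ ((4 : ENNReal).toReal) = x ^ (4 : ℕ) := fun x => by
        rw [← Real.rpow_natCast]; norm_num
      simpa only [e] using h4)
  exact this

variable [IsProbabilityMeasure P]

lemma integral_sq_le_of_cosh (ht : 0 < t) (hX : Measurable X)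
    (hc : ∫⁻ ω, ENNReal.ofReal (Real.cosh (X ω / t)) ∂P ≤ 2) :
    ∫ ω, X ω ^ 2 ∂P ≤ 2 * t ^ 2 := by
  have hi := integrable_cosh_div hX hc
  have hi2 : Integrable (fun ω => X ω ^ 2) P :=
    ((memLp_four_of_cosh ht hX hc).mono_exponent (by norm_num)).integrable_sq
  calc ∫ ω, X ω ^ 2 ∂P ≤ ∫ ω, 2 * t ^ 2 * (Real.cosh (X ω / t) - 1) ∂P := by
        refine integral_mono hi2 ((hi.sub (integrable_const 1)).const_mul _) fun ω => ?_
        have h := pow_div_factorial_le_cosh_sub_one (X ω / t) (p := 1) (by norm_num)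
        rw [mul_one, div_pow, Nat.factorial_two, div_div, div_le_iff₀ (by positivity)] at h
        push_cast at h
        linarith
    _ = 2 * t ^ 2 * (∫ ω, Real.cosh (X ω / t) ∂P - 1) := by
        rw [integral_const_mul, integral_sub hi (integrable_const 1)]
        simp
    _ ≤ 2 * t ^ 2 := by
        have := integral_cosh_div_le hX hc
        nlinarith [sq_nonneg t]

/-- The symmetrized moment is `2 E cosh(cX)`, which has no linear term. The quadratic gain of
`cosh_mul_sub_one_le` therefore gives a sub-gaussian bound for small `c` without any assumption on
the mean. -/
lemma lintegral_exp_add_lintegral_exp_neg_le (ht : 0 < t) (hX : Measurable X)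
    (hc : ∫⁻ ω, ENNReal.ofReal (Real.cosh (X ω / t)) ∂P ≤ 2) {c : ℝ} (hct : |c * t| ≤ 1) :
    ∫⁻ ω, ENNReal.ofReal (Real.exp (c * X ω)) ∂P + ∫⁻ ω, ENNReal.ofReal (Real.exp (-c * X ω)) ∂P
      ≤ 2 * ENNReal.ofReal (Real.exp ((c * t) ^ 2)) := by
  have hi := integrable_cosh_div hX hc
  have hpt : ∀ ω, Real.exp (c * X ω) + Real.exp (-c * X ω) ≤
      2 * (1 + (c * t) ^ 2 * (Real.cosh (X ω / t) - 1)) := by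
    intro ω
    have h := cosh_mul_sub_one_le hct (X ω / t)
    rw [mul_assoc, mul_div_cancel₀ _ ht.ne', Real.cosh_eq (c * X ω)] at h
    rw [neg_mul]
    linarith
  rw [← lintegral_add_left (by fun_prop)]
  calc ∫⁻ ω, (ENNReal.ofReal (Real.exp (c * X ω)) + ENNReal.ofReal (Real.exp (-c * X ω))) ∂P
      ≤ ∫⁻ ω, ENNReal.ofReal (2 * (1 + (c * t) ^ 2 * (Real.cosh (X ω / t) - 1))) ∂P := by
        refine lintegral_mono fun ω => ?_
        rw [← ENNReal.ofReal_add (Real.exp_pos _).le (Real.exp_pos _).le]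
        exact ENNReal.ofReal_le_ofReal (hpt ω)
    _ = ENNReal.ofReal (∫ ω, 2 * (1 + (c * t) ^ 2 * (Real.cosh (X ω / t) - 1)) ∂P) := by
        rw [ofReal_integral_eq_lintegral_ofReal]
        · exact ((integrable_const _).add ((hi.sub (integrable_const 1)).const_mul _)).const_mul _
        · exact Filter.Eventually.of_forall fun ω => le_trans (by positivity) (hpt ω)
    _ ≤ ENNReal.ofReal (2 * Real.exp ((c * t) ^ 2)) := by
        refine ENNReal.ofReal_le_ofReal ?_
        have h1 : ∫ ω, (1 + (c * t) ^ 2 * (Real.cosh (X ω / t) - 1)) ∂P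
            = 1 + (c * t) ^ 2 * (∫ ω, Real.cosh (X ω / t) ∂P - 1) := by
          have hi' : Integrable (fun ω => Real.cosh (X ω / t) - 1) P := hi.sub (integrable_const 1)
          rw [integral_add (integrable_const _) (hi'.const_mul _), integral_const_mul,
            integral_sub hi (integrable_const 1)]
          simp
        rw [integral_const_mul, h1]
        have h2 := integral_cosh_div_le hX hc
        have h3 := Real.add_one_le_exp ((c * t) ^ 2)
        nlinarith [sq_nonneg (c * t)]
    _ = 2 * ENNReal.ofReal (Real.exp ((c * t) ^ 2)) := by
        rw [ENNReal.ofReal_mul (by norm_num)]; simp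

end CoshMoment

/-! ### Low moments of weighted sums of independent centered variables. -/

section SmallBall

variable {Ω : Type*} [MeasurableSpace Ω] {P : Measure Ω}

lemma ProbabilityTheory.IndepFun.integral_pow_mul_pow {U W : Ω → ℝ} (h : IndepFun U W P)
    (hU : MemLp U 4 P) (hW : MemLp W 4 P) (p q : ℕ) :
    ∫ ω, U ω ^ p * W ω ^ q ∂P = (∫ ω, U ω ^ p ∂P) * ∫ ω, W ω ^ q ∂P :=
  (h.comp (measurable_id.pow_const p) (measurable_id.pow_const q)).integral_fun_mul_eq_mul_integral
    (hU.aestronglyMeasurable.pow p) (hW.aestronglyMeasurable.pow q)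

variable [IsProbabilityMeasure P]

lemma MeasureTheory.MemLp.integrable_pow_of_le_four {U : Ω → ℝ} (hU : MemLp U 4 P) {p : ℕ}
    (hp : p ≤ 4) : Integrable (fun ω => U ω ^ p) P := by
  have h : MemLp U p P := hU.mono_exponent (by exact_mod_cast hp)
  refine (integrable_norm_iff (hU.aestronglyMeasurable.pow p)).1 ?_
  simpa [norm_pow] using h.integrable_norm_pow'

lemma ProbabilityTheory.IndepFun.integrable_pow_mul_pow {U W : Ω → ℝ} (h : IndepFun U W P)
    (hU : MemLp U 4 P) (hW : MemLp W 4 P) {p q : ℕ} (hp : p ≤ 4) (hq : q ≤ 4) :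
    Integrable (fun ω => U ω ^ p * W ω ^ q) P :=
  (h.comp (measurable_id.pow_const p) (measurable_id.pow_const q)).integrable_mul
    (hU.integrable_pow_of_le_four hp) (hW.integrable_pow_of_le_four hq)

/-- Moments of a sum of independent random variables. -/
lemma ProbabilityTheory.IndepFun.integral_add_pow {U W : Ω → ℝ} (h : IndepFun U W P)
    (hU : MemLp U 4 P) (hW : MemLp W 4 P) {p : ℕ} (hp : p ≤ 4) :
    ∫ ω, (U ω + W ω) ^ p ∂P = ∑ i ∈ Finset.range (p + 1),
      (∫ ω, U ω ^ i ∂P) * (∫ ω, W ω ^ (p - i) ∂P) * (p.choose i) := by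
  simp only [add_pow]
  rw [integral_finsetSum]
  · refine Finset.sum_congr rfl fun i _ => ?_
    rw [integral_mul_const, h.integral_pow_mul_pow hU hW]
  · intro i hi
    have := Finset.mem_range.1 hi
    exact (h.integrable_pow_mul_pow hU hW (by omega) (by omega)).mul_const _

/-- The first four moments of a weighted sum of independent centered random variables. -/
lemma integral_sum_pow_le {ι : Type*} {Z : ι → Ω → ℝ} {x : ι → ℝ} {v m₃ m₄ : ℝ}
    (hZ : iIndepFun Z P) (hZm : ∀ j, Measurable (Z j)) (hZ4 : ∀ j, MemLp (Z j) 4 P)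
    (hx : ∀ j, |x j| ≤ 1)
    (h1 : ∀ j, ∫ ω, Z j ω ∂P = 0) (h2 : ∀ j, ∫ ω, Z j ω ^ 2 ∂P = v)
    (h3 : ∀ j, |∫ ω, Z j ω ^ 3 ∂P| ≤ m₃) (h4 : ∀ j, ∫ ω, Z j ω ^ 4 ∂P ≤ m₄)
    (hv : 3 * v ^ 2 ≤ m₄) (s : Finset ι) :
    MemLp (fun ω => ∑ j ∈ s, x j * Z j ω) 4 P ∧
    ∫ ω, (∑ j ∈ s, x j * Z j ω) ∂P = 0 ∧
    ∫ ω, (∑ j ∈ s, x j * Z j ω) ^ 2 ∂P = v * ∑ j ∈ s, x j ^ 2 ∧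
    |∫ ω, (∑ j ∈ s, x j * Z j ω) ^ 3 ∂P| ≤ m₃ * ∑ j ∈ s, x j ^ 2 ∧
    ∫ ω, (∑ j ∈ s, x j * Z j ω) ^ 4 ∂P ≤ m₄ * (∑ j ∈ s, x j ^ 2) ^ 2 := by
  classical
  induction s using Finset.induction_on with
  | empty => simp
  | insert a s ha ih =>
    obtain ⟨i0, i1, i2, i3, i4⟩ := ih
    set q := ∑ j ∈ s, x j ^ 2 with hq
    have hq0 : 0 ≤ q := Finset.sum_nonneg fun j _ => sq_nonneg _
    have hW4 : MemLp (fun ω => x a * Z a ω) 4 P := (hZ4 a).const_mul (x a)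
    have hind : IndepFun (fun ω => ∑ j ∈ s, x j * Z j ω) (fun ω => x a * Z a ω) P := by
      have h := (hZ.comp (fun j z => x j * z) fun j => measurable_const_mul (x j))
      have h' := h.indepFun_finsetSum_of_notMem
        (fun j => (hZm j).const_mul (x j)) ha
      convert h' using 1
      · ext ω
        simp [Finset.sum_apply]
      · rfl
    have hpow : ∀ p : ℕ, ∫ ω, (x a * Z a ω) ^ p ∂P = x a ^ p * ∫ ω, Z a ω ^ p ∂P := fun p => by
      simp only [mul_pow]; rw [integral_const_mul]
    have hW1 : ∫ ω, x a * Z a ω ∂P = 0 := by rw [integral_const_mul, h1, mul_zero]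
    have hadd : ∀ ω, ∑ j ∈ insert a s, x j * Z j ω = ∑ j ∈ s, x j * Z j ω + x a * Z a ω :=
      fun ω => by rw [Finset.sum_insert ha, add_comm]
    have hsq : ∑ j ∈ insert a s, x j ^ 2 = q + x a ^ 2 := by
      rw [Finset.sum_insert ha, add_comm]
    simp only [hadd]
    rw [hsq]
    refine ⟨i0.add hW4, ?_, ?_, ?_, ?_⟩
    · rw [integral_add (i0.integrable (by norm_num)) (hW4.integrable (by norm_num)), i1, hW1,
        add_zero]
    · rw [hind.integral_add_pow i0 hW4 (by norm_num)]
      simp only [Finset.sum_range_succ, Finset.sum_range_zero]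
      simp [hW1, i1, i2, hpow, h2]
      ring
    · rw [hind.integral_add_pow i0 hW4 (by norm_num)]
      simp only [Finset.sum_range_succ, Finset.sum_range_zero]
      simp only [pow_one, i1, Nat.sub_self, pow_zero, integral_const, probReal_univ,
        zero_mul, add_zero, one_smul, one_mul, mul_one, Nat.choose_zero_right,
        Nat.choose_self, Nat.cast_one, Nat.sub_zero, zero_add, hpow]
      norm_num [h1 a]
      -- The only use of `|x a| ≤ 1`: the cube is bounded by the square, so the third moments sum
      -- like variances.
      have hx3 : |x a ^ 3 * ∫ ω, Z a ω ^ 3 ∂P| ≤ m₃ * x a ^ 2 := by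
        rw [abs_mul, abs_pow]
        have : |x a| ^ 3 ≤ x a ^ 2 := by
          rw [← sq_abs (x a)]
          exact pow_le_pow_of_le_one (abs_nonneg _) (hx a) (by norm_num)
        calc |x a| ^ 3 * |∫ ω, Z a ω ^ 3 ∂P| ≤ x a ^ 2 * m₃ :=
              mul_le_mul this (h3 a) (abs_nonneg _) (sq_nonneg _)
          _ = m₃ * x a ^ 2 := mul_comm _ _
      refine (abs_add_le _ _).trans ?_
      linarith
    · rw [hind.integral_add_pow i0 hW4 (by norm_num)]
      simp only [Finset.sum_range_succ, Finset.sum_range_zero]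
      simp only [pow_one, i1, Nat.sub_self, pow_zero, integral_const, probReal_univ,
        zero_mul, add_zero, one_smul, one_mul, mul_one, Nat.choose_zero_right,
        Nat.choose_self, Nat.cast_one, Nat.sub_zero, zero_add, hpow]
      norm_num [h1 a, Nat.choose]
      rw [i2, h2]
      have hx4 : 0 ≤ x a ^ 4 := by positivity
      have := mul_le_mul_of_nonneg_left (h4 a) hx4
      -- Centering leaves the single cross term `6 v^2 q (x a)^2`; by `3 v^2 ≤ m₄` it fits into the
      -- cross term of `m₄ (q + (x a)^2)^2`.
      have := mul_le_mul_of_nonneg_right hv (mul_nonneg hq0 (sq_nonneg (x a)))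
      nlinarith
end SmallBall

/-! ### Paley–Zygmund and the small-ball estimate for one row. -/

section PaleyZygmund

variable {Ω : Type*} [MeasurableSpace Ω] {P : Measure Ω} [IsProbabilityMeasure P]

/-- The Paley–Zygmund inequality for `Z ^ 2`. -/
lemma sq_integral_sq_sub_le {Z : Ω → ℝ} (hZm : Measurable Z) (hZ : MemLp Z 4 P) {η : ℝ}
    (h : η ^ 2 < ∫ ω, Z ω ^ 2 ∂P) :
    (∫ ω, Z ω ^ 2 ∂P - η ^ 2) ^ 2 ≤ (∫ ω, Z ω ^ 4 ∂P) * P.real {ω | η ≤ |Z ω|} := by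
  set D := ∫ ω, Z ω ^ 2 ∂P - η ^ 2 with hD
  set F := ∫ ω, Z ω ^ 4 ∂P with hF
  set E : Set Ω := {ω | η ≤ |Z ω|} with hE
  have hDpos : 0 < D := by linarith
  have hEm : MeasurableSet E := measurableSet_le measurable_const hZm.abs
  have h2 : Integrable (fun ω => Z ω ^ 2) P := hZ.integrable_pow_of_le_four (by norm_num)
  have h4 : Integrable (fun ω => Z ω ^ 4) P := hZ.integrable_pow_of_le_four (by norm_num)
  have hind : Integrable (E.indicator fun _ => (1 : ℝ)) P := (integrable_const 1).indicator hEm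
  have hindint : ∫ ω, E.indicator (fun _ => (1 : ℝ)) ω ∂P = P.real E := by
    rw [integral_indicator_const _ hEm]; simp
  -- Cauchy–Schwarz in additive form: `Z^2 ≤ (c/2) Z^4 + 1/(2c)` on `E`, and `Z^2 ≤ η^2` off `E`.
  -- Optimizing over `c` recovers the product.
  have key : ∀ c : ℝ, 0 < c → D ≤ c * F / 2 + P.real E / (2 * c) := by
    intro c hc
    have hpt : ∀ ω, Z ω ^ 2 - η ^ 2 ≤
        c / 2 * Z ω ^ 4 + 1 / (2 * c) * E.indicator (fun _ => (1 : ℝ)) ω := by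
      intro ω
      by_cases hω : ω ∈ E
      · rw [Set.indicator_of_mem hω, mul_one]
        have : 0 ≤ 1 / (2 * c) * (c * Z ω ^ 2 - 1) ^ 2 := by positivity
        have e : 1 / (2 * c) * (c * Z ω ^ 2 - 1) ^ 2
            = c / 2 * Z ω ^ 4 + 1 / (2 * c) - Z ω ^ 2 := by field_simp; ring
        linarith [sq_nonneg η]
      · rw [Set.indicator_of_notMem hω, mul_zero, add_zero]
        have h1 : |Z ω| < η := not_le.1 hω
        have h3 : Z ω ^ 2 ≤ η ^ 2 := by
          rw [← sq_abs]; exact pow_le_pow_left₀ (abs_nonneg _) h1.le 2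
        have : 0 ≤ c / 2 * Z ω ^ 4 := by positivity
        linarith
    have hi := integral_mono (h2.sub (integrable_const (η ^ 2)))
      ((h4.const_mul (c / 2)).add (hind.const_mul (1 / (2 * c)))) hpt
    rw [integral_sub' h2 (integrable_const _), integral_add' (h4.const_mul _) (hind.const_mul _),
      integral_const_mul, integral_const_mul, hindint] at hi
    simp only [integral_const, probReal_univ, one_smul] at hi
    calc D ≤ c / 2 * F + 1 / (2 * c) * P.real E := hi
      _ = _ := by ring
  have hFpos : 0 < F := by
    by_contra hcon
    have hF0 : F ≤ 0 := not_lt.1 hcon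
    -- If `F ≤ 0`, this large `c` makes the right side of `key` at most `D/2`, a contradiction.
    have hc : 0 < (P.real E + 1) / D := by positivity
    have := key _ hc
    have h5 : (P.real E + 1) / D * F / 2 ≤ 0 := by
      have := mul_nonpos_of_nonneg_of_nonpos hc.le hF0
      linarith
    have h6 : P.real E / (2 * ((P.real E + 1) / D)) = D * (P.real E / (P.real E + 1)) / 2 := by
      have : P.real E + 1 ≠ 0 := by positivity
      field_simp
    have h7 : P.real E / (P.real E + 1) ≤ 1 := (div_le_one (by positivity)).2 (by linarith)
    rw [h6] at this
    nlinarith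
  have := key (D / F) (by positivity)
  have e : D / F * F / 2 + P.real E / (2 * (D / F)) = D / 2 + F * P.real E / (2 * D) := by
    field_simp
  rw [e] at this
  have h8 : D / 2 ≤ F * P.real E / (2 * D) := by linarith
  rw [le_div_iff₀ (by positivity)] at h8
  nlinarith

/-- Uniform control of the kurtosis under a shift `b`. The third-moment term is absorbed by AM–GM:
`4 v^2 |b| = (2√v |b|) · v · (2√v) ≤ (v + b^2)^2 (1 + v)`, which is why `K` contains both `μ₃` and
`μ₂ μ₃`. The remaining terms are compared coefficientwise with `(v + b^2)^2 (v^2 + m₄)`, using `v^2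
≤ m₄`. -/
lemma fourth_moment_ratio_le {v b m₃ m₄ K y₃ y₄ : ℝ} (hv : 0 < v) (hm₃ : 0 ≤ m₃)
    (hm₄ : v ^ 2 ≤ m₄) (hK : v ^ 2 + m₃ + v * m₃ + m₄ ≤ K) (hy₃ : |y₃| ≤ m₃)
    (hy₄ : y₄ ≤ max (3 * v ^ 2) m₄) :
    2 * v ^ 2 * (b ^ 4 + 6 * b ^ 2 * v + 4 * b * y₃ + y₄) ≤ 3 * (v + b ^ 2) ^ 2 * K := by
  set σ := Real.sqrt v with hσ
  have hσ0 : 0 < σ := Real.sqrt_pos.2 hv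
  have hσv : σ ^ 2 = v := Real.sq_sqrt hv.le
  have hb : b * y₃ ≤ |b| * m₃ := (le_abs_self _).trans (by
    rw [abs_mul]; exact mul_le_mul_of_nonneg_left hy₃ (abs_nonneg _))
  have hbs : |b| ^ 2 = b ^ 2 := sq_abs b
  have hb0 := abs_nonneg b
  have h1 : v ^ 2 * |b| * 8 * m₃ ≤ 3 * (v + b ^ 2) ^ 2 * (m₃ + v * m₃) := by
    have e1 : 2 * σ ≤ 1 + v := by nlinarith [sq_nonneg (σ - 1)]
    have e2 : 2 * σ * |b| ≤ v + b ^ 2 := by nlinarith [sq_nonneg (σ - |b|)]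
    have e3 : v ≤ v + b ^ 2 := by linarith [sq_nonneg b]
    have e4 : (2 * σ * |b|) * v ≤ (v + b ^ 2) * (v + b ^ 2) :=
      mul_le_mul e2 e3 hv.le (by positivity)
    have e5 : (2 * σ * |b|) * v * (2 * σ) ≤ (v + b ^ 2) * (v + b ^ 2) * (1 + v) :=
      mul_le_mul e4 e1 (by positivity) (by positivity)
    have e6 : (2 * σ * |b|) * v * (2 * σ) = 4 * v ^ 2 * |b| := by
      calc _ = 4 * σ ^ 2 * |b| * v := by ring
        _ = _ := by rw [hσv]; ring
    rw [e6] at e5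
    have e7 := mul_le_mul_of_nonneg_right e5 hm₃
    have e8 : 0 ≤ v ^ 2 * |b| * m₃ := by positivity
    nlinarith
  have h2 : 2 * v ^ 2 * (b ^ 4 + 6 * b ^ 2 * v + y₄) ≤ 3 * (v + b ^ 2) ^ 2 * (v ^ 2 + m₄) := by
    have hb2 : 0 ≤ b ^ 2 := sq_nonneg b
    have hb4 : 0 ≤ b ^ 4 := by positivity
    have hv2 : 0 < v ^ 2 := by positivity
    have hg : 0 ≤ m₄ - v ^ 2 := by linarith
    have p1 : 0 ≤ (m₄ - v ^ 2) * b ^ 4 := by positivity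
    have p2 : 0 ≤ (m₄ - v ^ 2) * (v * b ^ 2) := by positivity
    have p3 : 0 ≤ (m₄ - v ^ 2) * v ^ 2 := by positivity
    have p4 : 0 ≤ v ^ 2 * b ^ 4 := by positivity
    rcases le_total (3 * v ^ 2) m₄ with h | h
    · rw [max_eq_right h] at hy₄
      have := mul_le_mul_of_nonneg_left hy₄ hv2.le
      nlinarith
    · rw [max_eq_left h] at hy₄
      have := mul_le_mul_of_nonneg_left hy₄ hv2.le
      nlinarith
  have h3 : 3 * (v + b ^ 2) ^ 2 * (v ^ 2 + m₃ + v * m₃ + m₄) ≤ 3 * (v + b ^ 2) ^ 2 * K :=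
    mul_le_mul_of_nonneg_left hK (by positivity)
  have h4 : v ^ 2 * (b * y₃) ≤ v ^ 2 * (|b| * m₃) := mul_le_mul_of_nonneg_left hb (by positivity)
  nlinarith

lemma sq_integral_sq_le {Z : Ω → ℝ} (hZ : MemLp Z 4 P) :
    (∫ ω, Z ω ^ 2 ∂P) ^ 2 ≤ ∫ ω, Z ω ^ 4 ∂P := by
  set v := ∫ ω, Z ω ^ 2 ∂P with hv
  have h2 : Integrable (fun ω => Z ω ^ 2) P := hZ.integrable_pow_of_le_four (by norm_num)
  have h4 : Integrable (fun ω => Z ω ^ 4) P := hZ.integrable_pow_of_le_four (by norm_num)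
  have h : 0 ≤ ∫ ω, (Z ω ^ 2 - v) ^ 2 ∂P := integral_nonneg fun ω => sq_nonneg _
  have e : ∀ ω, (Z ω ^ 2 - v) ^ 2 = Z ω ^ 4 - 2 * v * Z ω ^ 2 + v ^ 2 := fun ω => by ring
  simp only [e] at h
  have h5 : Integrable (fun ω => Z ω ^ 4 - 2 * v * Z ω ^ 2) P := h4.sub (h2.const_mul _)
  rw [integral_add h5 (integrable_const _), integral_sub h4 (h2.const_mul _),
    integral_const_mul] at h
  simp only [integral_const, probReal_univ, one_smul] at h
  rw [← hv] at h
  nlinarith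

/-- Small-ball estimate for the marginals of a vector with independent entries of equal variance
and arbitrary means. -/
lemma smallBall_of_iIndepFun {ι : Type*} [Fintype ι] {X : ι → Ω → ℝ} {x : ι → ℝ}
    {v m₃ m₄ K : ℝ} (hX : iIndepFun X P) (hXm : ∀ j, Measurable (X j))
    (hX4 : ∀ j, MemLp (X j) 4 P) (hx : ∑ j, x j ^ 2 = 1) (hv : 0 < v)
    (h2 : ∀ j, centralMoment (X j) 2 P = v) (h3 : ∀ j, |centralMoment (X j) 3 P| ≤ m₃)
    (h4 : ∀ j, |centralMoment (X j) 4 P| ≤ m₄) (hK : v ^ 2 + m₃ + v * m₃ + m₄ ≤ K) :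
    0.65 * (v ^ 2 / K) ≤ P.real {ω | Real.sqrt v / 10 ≤ |∑ j, X j ω * x j|} := by
  obtain ⟨j₀⟩ : Nonempty ι := by
    by_contra hne
    rw [not_nonempty_iff] at hne
    simp at hx
  set Z : ι → Ω → ℝ := fun j ω => X j ω - ∫ ω, X j ω ∂P with hZ
  have hcm : ∀ j p, centralMoment (X j) p P = ∫ ω, Z j ω ^ p ∂P := fun j p => by
    simp [centralMoment, hZ]
  simp only [hcm] at h2 h3 h4
  have hZ4 : ∀ j, MemLp (Z j) 4 P := fun j => (hX4 j).sub (memLp_const _)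
  have hZi : iIndepFun Z P :=
    hX.comp (fun j z => z - ∫ ω, X j ω ∂P) fun j => measurable_id.sub_const _
  have hZm : ∀ j, Measurable (Z j) := fun j => (hXm j).sub_const _
  have hZ1 : ∀ j, ∫ ω, Z j ω ∂P = 0 := fun j => by
    simp only [hZ]
    rw [integral_sub ((hX4 j).integrable (by norm_num)) (integrable_const _)]
    simp
  have hx1 : ∀ j, |x j| ≤ 1 := fun j => by
    rw [← sq_le_one_iff_abs_le_one, ← hx]
    exact Finset.single_le_sum (f := fun j => x j ^ 2) (fun j _ => sq_nonneg _) (Finset.mem_univ j)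
  have hm₃ : 0 ≤ m₃ := (abs_nonneg _).trans (h3 j₀)
  have hm₄ : v ^ 2 ≤ m₄ := by
    rw [← h2 j₀]
    exact (sq_integral_sq_le (hZ4 j₀)).trans ((le_abs_self _).trans (h4 j₀))
  -- The maximum with `3 v^2` accounts for the Gaussian-like part of the fourth moment of a sum.
  obtain ⟨i0, i1, i2, i3, i4⟩ := integral_sum_pow_le (m₄ := max (3 * v ^ 2) m₄) hZi hZm hZ4 hx1 hZ1
    h2 h3 (fun j => ((le_abs_self _).trans (h4 j)).trans (le_max_right _ _)) (le_max_left _ _)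
    Finset.univ
  rw [hx, mul_one] at i2 i3
  rw [hx, one_pow, mul_one] at i4
  set Y : Ω → ℝ := fun ω => ∑ j, x j * Z j ω with hY
  set b := ∑ j, x j * ∫ ω, X j ω ∂P with hb
  have hsum : ∀ ω, ∑ j, X j ω * x j = Y ω + b := fun ω => by
    rw [hY, hb, ← Finset.sum_add_distrib]
    refine Finset.sum_congr rfl fun j _ => ?_
    simp only [hZ]; ring
  have hYm : Measurable Y := Finset.measurable_sum _ fun j _ => (hZm j).const_mul _
  have hint : ∀ p ≤ 4, Integrable (fun ω => Y ω ^ p) P := fun p hp =>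
    i0.integrable_pow_of_le_four hp
  have hY1 : Integrable Y P := i0.integrable (by norm_num)
  have e2 : ∫ ω, (Y ω + b) ^ 2 ∂P = v + b ^ 2 := by
    have e : ∀ ω, (Y ω + b) ^ 2 = Y ω ^ 2 + (2 * b * Y ω + b ^ 2) := fun ω => by ring
    have j1 : Integrable (fun ω => 2 * b * Y ω + b ^ 2) P :=
      (hY1.const_mul _).add (integrable_const _)
    simp only [e]
    rw [integral_add (hint 2 (by norm_num)) j1,
      integral_add (hY1.const_mul _) (integrable_const _), integral_const_mul, i1, i2]
    simp
  have e4 : ∫ ω, (Y ω + b) ^ 4 ∂P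
      = b ^ 4 + 6 * b ^ 2 * v + 4 * b * (∫ ω, Y ω ^ 3 ∂P) + ∫ ω, Y ω ^ 4 ∂P := by
    have e : ∀ ω, (Y ω + b) ^ 4 = Y ω ^ 4 + (4 * b * Y ω ^ 3 + (6 * b ^ 2 * Y ω ^ 2 +
      (4 * b ^ 3 * Y ω + b ^ 4))) := fun ω => by ring
    have j1 : Integrable (fun ω => 4 * b ^ 3 * Y ω + b ^ 4) P :=
      (hY1.const_mul _).add (integrable_const _)
    have j2 : Integrable (fun ω => 6 * b ^ 2 * Y ω ^ 2 + (4 * b ^ 3 * Y ω + b ^ 4)) P :=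
      ((hint 2 (by norm_num)).const_mul _).add j1
    have j3 : Integrable (fun ω => 4 * b * Y ω ^ 3 +
        (6 * b ^ 2 * Y ω ^ 2 + (4 * b ^ 3 * Y ω + b ^ 4))) P :=
      ((hint 3 (by norm_num)).const_mul _).add j2
    simp only [e]
    rw [integral_add (hint 4 le_rfl) j3,
      integral_add ((hint 3 (by norm_num)).const_mul _) j2,
      integral_add ((hint 2 (by norm_num)).const_mul _) j1,
      integral_add (hY1.const_mul _) (integrable_const _)]
    simp only [integral_const_mul, integral_const, probReal_univ, one_smul]
    rw [i1, i2]
    ring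
  have hratio := fourth_moment_ratio_le (b := b) hv hm₃ hm₄ hK i3 i4
  rw [← e4] at hratio
  have hη : (Real.sqrt v / 10) ^ 2 = v / 100 := by
    rw [div_pow, Real.sq_sqrt hv.le]; norm_num
  have hpz := sq_integral_sq_sub_le (P := P) (Z := fun ω => Y ω + b) (hYm.add_const b)
    (i0.add (memLp_const b)) (η := Real.sqrt v / 10)
    (by rw [hη, e2]; nlinarith [sq_nonneg b])
  rw [e2, hη] at hpz
  simp only [hsum]
  set p := P.real {ω | Real.sqrt v / 10 ≤ |Y ω + b|} with hp
  have hp0 : 0 ≤ p := measureReal_nonneg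
  have hKpos : 0 < K := by nlinarith [mul_nonneg hv.le hm₃]
  set G := v + b ^ 2 with hG
  have hGpos : 0 < G := by nlinarith [sq_nonneg b]
  have hGD : 0.99 * G ≤ G - v / 100 := by nlinarith [sq_nonneg b]
  have h99 : (0.99 * G) ^ 2 ≤ (G - v / 100) ^ 2 := pow_le_pow_left₀ (by positivity) hGD 2
  have h5 := mul_le_mul_of_nonneg_right hratio hp0
  have h6 : 2 * v ^ 2 * (0.99 * G) ^ 2 ≤ 3 * G ^ 2 * K * p := by
    refine le_trans ?_ h5
    rw [mul_assoc (2 * v ^ 2)]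
    exact mul_le_mul_of_nonneg_left (h99.trans hpz) (by positivity)
  -- `2 · 0.99^2 = 1.9602`, and `1.9602 / 3 > 0.65`.
  have h7 : 1.9602 * v ^ 2 ≤ 3 * K * p := by
    have : G ^ 2 * (1.9602 * v ^ 2) ≤ G ^ 2 * (3 * K * p) := by nlinarith
    exact le_of_mul_le_mul_left this (by positivity)
  rw [← mul_div_assoc, div_le_iff₀ hKpos]
  nlinarith [sq_nonneg v]

end PaleyZygmund

/-! ### Independence of rows from independence of entries. -/

section Grouping

variable {Ω : Type*} [MeasurableSpace Ω] {P : Measure Ω} [IsProbabilityMeasure P]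

/-- Independent variables indexed by pairs can be grouped along the first index. -/
lemma ProbabilityTheory.iIndepFun.curry {ι κ 𝓧 : Type*} [MeasurableSpace 𝓧]
    {X : ι → κ → Ω → 𝓧} (hX : ∀ i j, Measurable (X i j))
    (h : iIndepFun (fun (p : ι × κ) ω => X p.1 p.2 ω) P) :
    iIndepFun (fun i ω (j : κ) => X i j ω) P := by
  have hp : ∀ i j, IsProbabilityMeasure (P.map (X i j)) := fun i j =>
    Measure.isProbabilityMeasure_map (hX i j).aemeasurable
  have hrow : ∀ i, P.map (fun ω j => X i j ω) = Measure.infinitePi fun j => P.map (X i j) :=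
    fun i => (iIndepFun_iff_map_fun_eq_infinitePi_map (hX i)).1
      (h.precomp (g := fun j : κ => (i, j)) (Prod.mk_right_injective i))
  rw [iIndepFun_iff_map_fun_eq_infinitePi_map fun i => measurable_pi_lambda _ fun j => hX i j]
  simp only [hrow]
  rw [← Measure.infinitePi_map_curry (fun i j => P.map (X i j)),
    ← (iIndepFun_iff_map_fun_eq_infinitePi_map fun p : ι × κ => hX p.1 p.2).1 h,
    Measure.map_map (MeasurableEquiv.measurable _)
      (measurable_pi_lambda _ fun p : ι × κ => hX p.1 p.2)]
  rfl

end Grouping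

/-! ### Uniform lower bound for the sum of pair responses. -/

section UniformLowerBound

variable {n : ℕ}

/-- The response equals one unless both rows are small, which by independence has probability at
most `(1 - q)^2`. -/
lemma le_integral_pairResponse {η : ℝ} (hη : 0 < η) (x : Fin n → ℝ) (ρ₁ ρ₂ : Measure (Fin n → ℝ))
    [IsProbabilityMeasure ρ₁] [IsProbabilityMeasure ρ₂] {q : ℝ} (hq : q ≤ 1)
    (h₁ : q ≤ ρ₁.real {v | η ≤ |∑ j, v j * x j|}) (h₂ : q ≤ ρ₂.real {v | η ≤ |∑ j, v j * x j|}) :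
    q * (2 - q) ≤ ∫ y, pairResponse η y x ∂(ρ₁.prod ρ₂) := by
  set E : Set (Fin n → ℝ) := {v | η ≤ |∑ j, v j * x j|} with hE
  have hEm : MeasurableSet E := measurableSet_le measurable_const (by fun_prop)
  have hG : MeasurableSet (Eᶜ ×ˢ Eᶜ) := hEm.compl.prod hEm.compl
  have hcompl : ∀ ρ : Measure (Fin n → ℝ), IsProbabilityMeasure ρ → q ≤ ρ.real E →
      ρ.real Eᶜ ≤ 1 - q := fun ρ hρ h => by
    rw [measureReal_compl hEm, probReal_univ]; linarith
  have hind : ∫ y, (Eᶜ ×ˢ Eᶜ)ᶜ.indicator (fun _ => (1 : ℝ)) y ∂(ρ₁.prod ρ₂)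
      = 1 - ρ₁.real Eᶜ * ρ₂.real Eᶜ := by
    rw [integral_indicator_const _ hG.compl, measureReal_compl hG, probReal_univ,
      measureReal_prod_prod]
    simp
  have hmono : ∫ y, (Eᶜ ×ˢ Eᶜ)ᶜ.indicator (fun _ => (1 : ℝ)) y ∂(ρ₁.prod ρ₂)
      ≤ ∫ y, pairResponse η y x ∂(ρ₁.prod ρ₂) := by
    refine integral_mono ((integrable_const 1).indicator hG.compl)
      (integrable_pairResponse hη x _) fun y => ?_
    by_cases hy : y ∈ (Eᶜ ×ˢ Eᶜ)ᶜ
    · rw [Set.indicator_of_mem hy]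
      have : y.1 ∈ E ∨ y.2 ∈ E := by
        by_contra hcon
        push Not at hcon
        exact hy ⟨hcon.1, hcon.2⟩
      refine le_min le_rfl ?_
      rw [le_div_iff₀ hη, one_mul]
      rcases this with h | h
      · exact le_max_of_le_left h
      · exact le_max_of_le_right h
    · rw [Set.indicator_of_notMem hy]
      exact pairResponse_nonneg hη y x
  rw [hind] at hmono
  have h3 := mul_le_mul (hcompl ρ₁ inferInstance h₁) (hcompl ρ₂ inferInstance h₂)
    measureReal_nonneg (by linarith)
  nlinarith

/-- Concentration of the minimum over `T` of the summed responses. Its mean is at least the smallest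
mean `M q (2 - q)` minus the expected supremum of the centered process, bounded by linear
domination. Changing one pair moves it by at most one, so McDiarmid applies with deviation `M u`. -/
lemma measureReal_exists_sum_pairResponse_le {M : ℕ} (hn : 0 < n) (hM : 0 < M)
    (ρ₁ ρ₂ : Fin M → Measure (Fin n → ℝ)) [∀ b, IsProbabilityMeasure (ρ₁ b)]
    [∀ b, IsProbabilityMeasure (ρ₂ b)]
    (hi₁ : ∀ b j, Integrable (fun v => v j) (ρ₁ b)) (hi₂ : ∀ b j, Integrable (fun v => v j) (ρ₂ b))
    {c β η : ℝ} (hc : 0 < c) (hβ : 0 < β) (hη : 0 < η)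
    (hb₁ : ∀ b j, ∫⁻ v, ENNReal.ofReal (Real.exp (c * v j)) ∂(ρ₁ b)
      + ∫⁻ v, ENNReal.ofReal (Real.exp (-c * v j)) ∂(ρ₁ b) ≤ 2 * ENNReal.ofReal β)
    (hb₂ : ∀ b j, ∫⁻ v, ENNReal.ofReal (Real.exp (c * v j)) ∂(ρ₂ b)
      + ∫⁻ v, ENNReal.ofReal (Real.exp (-c * v j)) ∂(ρ₂ b) ≤ 2 * ENNReal.ofReal β)
    {T : Type*} [Fintype T] [Nonempty T] (x : T → Fin n → ℝ) {R : ℝ}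
    (hR : ∀ t, ∑ j, |x t j| ≤ R) {q : ℝ} (hq : q ≤ 1)
    (hq₁ : ∀ b t, q ≤ (ρ₁ b).real {v | η ≤ |∑ j, v j * x t j|})
    (hq₂ : ∀ b t, q ≤ (ρ₂ b).real {v | η ≤ |∑ j, v j * x t j|}) {u a : ℝ} (hu : 0 ≤ u)
    (ha : a ≤ M * (q * (2 - q)) - 2 * R / (c * η) * Real.log (2 * n * β ^ (2 * M)) - M * u) :
    (Measure.pi fun b => (ρ₁ b).prod (ρ₂ b)).real
      {y | ∃ t, ∑ b, pairResponse η (y b) (x t) ≤ a} ≤ Real.exp (-(2 * M * u ^ 2)) := by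
  set ν : Fin M → Measure ((Fin n → ℝ) × (Fin n → ℝ)) := fun b => (ρ₁ b).prod (ρ₂ b) with hν
  -- The dominating direction carries a factor `2/η`, so the exponent `e` for it is the exponent `c`
  -- for the row entries.
  set e := c * η / 2 with he
  have hepos : 0 < e := by positivity
  have hce : 2 * e / η = c := by rw [he]; field_simp
  set m : Fin M → T → ℝ := fun b t => ∫ z, pairResponse η z (x t) ∂(ν b) with hm
  have hm_nonneg : ∀ b t, 0 ≤ m b t := fun b t =>
    integral_nonneg fun y => pairResponse_nonneg hη y _
  have hm_le : ∀ b t, m b t ≤ 1 := fun b t => by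
    have := integral_mono (integrable_pairResponse hη (x t) (ν b)) (integrable_const 1)
      fun y => pairResponse_le_one η y (x t)
    simpa using this
  have hdom : LinearlyDominated x e (ENNReal.ofReal (β ^ (2 * M))) (Measure.pi ν)
      (fun y t => ∑ b, (m b t - pairResponse η (y b) (x t))) := by
    have h := LinearlyDominated.pi (x := x) (e := e) (B := ENNReal.ofReal β ^ 2) ν
      (fun b y t => m b t - pairResponse η y (x t))
      (fun b t => (measurable_pairResponse η (x t)).const_sub _) (C := 1)
      (fun b y t => by
        rw [abs_le]
        constructor <;>
        linarith [hm_nonneg b t, hm_le b t, pairResponse_nonneg hη y (x t),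
          pairResponse_le_one η y (x t)])
      (fun b => linearlyDominated_pairResponse hη x e (ENNReal.ofReal β) (ρ₁ b) (ρ₂ b)
        (hi₁ b) (hi₂ b) (by rw [hce]; exact hb₁ b) (by rw [hce]; exact hb₂ b))
    rwa [← pow_mul, ← ENNReal.ofReal_pow hβ.le] at h
  have hW := hdom.integral_finMax_le hepos (by positivity) hn hR
  set W := R / e * Real.log (2 * n * β ^ (2 * M)) with hWdef
  have hWe : 2 * R / (c * η) * Real.log (2 * n * β ^ (2 * M)) = W := by
    rw [hWdef, he]; congr 1; field_simp
  set S : (Fin M → (Fin n → ℝ) × (Fin n → ℝ)) → T → ℝ :=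
    fun y t => ∑ b, pairResponse η (y b) (x t) with hS
  have hSm : ∀ t, Measurable fun y => S y t := fun t => Finset.measurable_sum _ fun b _ =>
    (measurable_pairResponse η (x t)).comp (measurable_pi_apply b)
  have hS0 : ∀ y t, 0 ≤ S y t := fun y t =>
    Finset.sum_nonneg fun b _ => pairResponse_nonneg hη _ _
  have hSM : ∀ y t, S y t ≤ M := fun y t => by
    refine (Finset.sum_le_sum fun b _ => pairResponse_le_one η (y b) (x t)).trans ?_
    simp
  -- The minimum over `t` of `S y t`.
  set F : (Fin M → (Fin n → ℝ) × (Fin n → ℝ)) → ℝ := fun y => -finMax (fun t => -S y t) with hF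
  have hFm : Measurable F := (measurable_finMax fun t => (hSm t).neg).neg
  have hFle : ∀ y t, F y ≤ S y t := fun y t => by
    have : -S y t ≤ _ := le_finMax (fun t => -S y t) t
    rw [hF]; linarith
  have hFex : ∀ y, ∃ t, F y = S y t := fun y => by
    obtain ⟨t, ht⟩ := exists_eq_finMax (fun t => -S y t)
    exact ⟨t, by rw [hF]; simp only; rw [ht, neg_neg]⟩
  have hFb : ∀ y, |F y| ≤ M := fun y => by
    obtain ⟨t, ht⟩ := hFex y
    rw [ht, abs_of_nonneg (hS0 y t)]
    exact hSM y t
  have hFd : ∀ i y z, (∀ j, j ≠ i → y j = z j) → F y - F z ≤ 1 := by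
    intro i y z hyz
    obtain ⟨t, ht⟩ := hFex z
    rw [ht]
    have h1 := hFle y t
    have h2 : S y t - S z t ≤ 1 := by
      rw [hS]
      simp only
      rw [← Finset.sum_sub_distrib, Finset.sum_eq_single i]
      · linarith [pairResponse_le_one η (y i) (x t), pairResponse_nonneg hη (z i) (x t)]
      · intro j _ hj
        rw [hyz j hj, sub_self]
      · simp
    linarith
  have hFi : Integrable F (Measure.pi ν) :=
    Integrable.of_bound hFm.aestronglyMeasurable M (Filter.Eventually.of_forall hFb)
  have hEF : M * (q * (2 - q)) - W ≤ ∫ y, F y ∂(Measure.pi ν) := by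
    have hi : Integrable (fun y => finMax fun t => ∑ b, (m b t - pairResponse η (y b) (x t)))
        (Measure.pi ν) := by
      have hmeas : ∀ t, Measurable fun y : Fin M → (Fin n → ℝ) × (Fin n → ℝ) =>
          ∑ b, (m b t - pairResponse η (y b) (x t)) := fun t =>
        Finset.measurable_sum _ fun b _ =>
          ((measurable_pairResponse η (x t)).comp (measurable_pi_apply b)).const_sub _
      refine integrable_finMax hmeas fun t => Integrable.of_bound
        (hmeas t).aestronglyMeasurable (M * 1) (Filter.Eventually.of_forall fun y => ?_)
      refine (Finset.abs_sum_le_sum_abs _ _).trans ((Finset.sum_le_sum fun b _ => ?_).trans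
        (by simp : ∑ _b : Fin M, (1 : ℝ) ≤ M * 1))
      rw [abs_le]
      constructor <;>
      linarith [hm_nonneg b t, hm_le b t, pairResponse_nonneg hη (y b) (x t),
          pairResponse_le_one η (y b) (x t)]
    have hpt : ∀ y, M * (q * (2 - q)) -
        finMax (fun t => ∑ b, (m b t - pairResponse η (y b) (x t))) ≤ F y := by
      intro y
      obtain ⟨t, ht⟩ := hFex y
      have h1 : ∑ b, (m b t - pairResponse η (y b) (x t)) ≤ _ :=
        le_finMax (fun t => ∑ b, (m b t - pairResponse η (y b) (x t))) t
      have h2 : M * (q * (2 - q)) ≤ ∑ b, m b t := by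
        have : ∑ _b : Fin M, q * (2 - q) ≤ ∑ b, m b t := Finset.sum_le_sum fun b _ =>
          le_integral_pairResponse hη (x t) (ρ₁ b) (ρ₂ b) hq (hq₁ b t) (hq₂ b t)
        simpa using this
      rw [Finset.sum_sub_distrib] at h1
      rw [ht]
      have h3 : S y t = ∑ b, pairResponse η (y b) (x t) := rfl
      linarith
    have h := integral_mono ((integrable_const _).sub hi) hFi hpt
    rw [integral_sub' (integrable_const _) hi] at h
    simp only [integral_const, probReal_univ, one_smul] at h
    linarith
  refine (measureReal_mono ?_).trans
    (measureReal_le_of_boundedDifferences hM ν hFm hFb hFd hu)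
  rintro y ⟨t, ht⟩
  have h1 : S y t ≤ a := ht
  have h2 := hFle y t
  change F y ≤ _
  linarith

/-- Cauchy–Schwarz over the pairs; injectivity of `f` ensures that no row is counted twice. -/
lemma sq_sum_pairResponse_le {M m : ℕ} {η : ℝ} (hη : 0 < η) (B : Matrix (Fin m) (Fin n) ℝ)
    (x : Fin n → ℝ) (f : Fin M × Fin 2 → Fin m) (hf : Function.Injective f) :
    η ^ 2 * (∑ b, pairResponse η (B (f (b, 0)), B (f (b, 1))) x) ^ 2 ≤
      M * ∑ i, (B.mulVec x) i ^ 2 := by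
  have h1 : ∀ b, η ^ 2 * pairResponse η (B (f (b, 0)), B (f (b, 1))) x ^ 2 ≤
      (B.mulVec x) (f (b, 0)) ^ 2 + (B.mulVec x) (f (b, 1)) ^ 2 := by
    intro b
    set p := (B.mulVec x) (f (b, 0)) with hp
    set r := (B.mulVec x) (f (b, 1)) with hr
    have h2 : pairResponse η (B (f (b, 0)), B (f (b, 1))) x ≤ max |p| |r| / η := min_le_right _ _
    rw [le_div_iff₀ hη] at h2
    have h3 := pow_le_pow_left₀ (mul_nonneg (pairResponse_nonneg hη _ _) hη.le) h2 2
    have h4 : max |p| |r| ^ 2 ≤ p ^ 2 + r ^ 2 := by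
      rcases max_cases |p| |r| with ⟨h, -⟩ | ⟨h, -⟩ <;> rw [h, sq_abs] <;> nlinarith
    calc _ = (pairResponse η (B (f (b, 0)), B (f (b, 1))) x * η) ^ 2 := by ring
      _ ≤ _ := h3.trans h4
  have h2 := sq_sum_le_card_mul_sum_sq (s := (Finset.univ : Finset (Fin M)))
    (f := fun b => pairResponse η (B (f (b, 0)), B (f (b, 1))) x)
  rw [Finset.card_univ, Fintype.card_fin] at h2
  have h3 : ∑ b : Fin M, ((B.mulVec x) (f (b, 0)) ^ 2 + (B.mulVec x) (f (b, 1)) ^ 2) ≤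
      ∑ i, (B.mulVec x) i ^ 2 := by
    have e : ∑ b : Fin M, ((B.mulVec x) (f (b, 0)) ^ 2 + (B.mulVec x) (f (b, 1)) ^ 2)
        = ∑ p : Fin M × Fin 2, (B.mulVec x) (f p) ^ 2 := by
      rw [Fintype.sum_prod_type]
      simp [Fin.sum_univ_two]
    rw [e, ← Finset.sum_image (s := Finset.univ) (f := fun i => (B.mulVec x) i ^ 2)
      (g := f) (fun a _ b _ h => hf h)]
    exact Finset.sum_le_sum_of_subset_of_nonneg (Finset.subset_univ _) fun i _ _ => sq_nonneg _
  calc η ^ 2 * (∑ b, pairResponse η (B (f (b, 0)), B (f (b, 1))) x) ^ 2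
      ≤ η ^ 2 * (M * ∑ b, pairResponse η (B (f (b, 0)), B (f (b, 1))) x ^ 2) :=
        mul_le_mul_of_nonneg_left h2 (sq_nonneg _)
    _ = M * ∑ b, η ^ 2 * pairResponse η (B (f (b, 0)), B (f (b, 1))) x ^ 2 := by
        rw [← Finset.mul_sum]; ring
    _ ≤ M * ∑ i, (B.mulVec x) i ^ 2 :=
        mul_le_mul_of_nonneg_left ((Finset.sum_le_sum fun b _ => h1 b).trans h3) (Nat.cast_nonneg _)

end UniformLowerBound

/-! ### Reduction of the null space property to a lower bound on unit vectors. -/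

section NullSpaceProperty

/-- A lower bound for `‖B x‖₂` on the unit vectors of small `ℓ₁`-norm implies the robust null
space property. -/
lemma satisfiesRNSP_of_lower_bound {m n : ℕ} {B : Matrix (Fin m) (Fin n) ℝ} {s : ℕ} {ρ τ : ℝ}
    (hs : 1 ≤ s) (hρ : 0 < ρ) (hρ1 : ρ < 1) (hτ : 0 < τ)
    (hB : ∀ x : Fin n → ℝ, ∑ j, x j ^ 2 = 1 → ∑ j, |x j| ≤ 2 * Real.sqrt s / ρ →
      1 / τ ^ 2 ≤ ∑ i, (B.mulVec x) i ^ 2) : SatisfiesRNSP B s ρ τ := by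
  intro S hS v
  by_contra hcon
  push Not at hcon
  set w := Real.sqrt (∑ j ∈ S, v j ^ 2) with hw
  set D := ∑ j ∈ Sᶜ, |v j| with hD
  set b := Real.sqrt (∑ i, (B.mulVec v) i ^ 2) with hb
  have hs0 : 0 < Real.sqrt s := Real.sqrt_pos.2 (by exact_mod_cast hs)
  have hD0 : 0 ≤ D := Finset.sum_nonneg fun j _ => abs_nonneg _
  have hb0 : 0 ≤ b := Real.sqrt_nonneg _
  have hτb : 0 ≤ τ * b := by positivity
  -- Failure puts `v` in the cone where `v_S` dominates. This bounds `‖v‖₁` by `(2√s/ρ) ‖v‖₂`, while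
  -- `w > τ b` will contradict the lower bound for `v / N`.
  have hw1 : ρ / Real.sqrt s * D < w := by linarith
  have hwpos : 0 < w := lt_of_le_of_lt (by positivity) hw1
  set N := Real.sqrt (∑ j, v j ^ 2) with hN
  have hwN : w ≤ N := Real.sqrt_le_sqrt
    (Finset.sum_le_sum_of_subset_of_nonneg (Finset.subset_univ _) fun j _ _ => sq_nonneg _)
  have hNpos : 0 < N := hwpos.trans_le hwN
  have hN2 : N ^ 2 = ∑ j, v j ^ 2 := Real.sq_sqrt (Finset.sum_nonneg fun j _ => sq_nonneg _)
  have hSl : ∑ j ∈ S, |v j| ≤ Real.sqrt s * w := by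
    have h1 := sq_sum_le_card_mul_sum_sq (s := S) (f := fun j => |v j|)
    simp only [sq_abs] at h1
    have h2 : (∑ j ∈ S, |v j|) ^ 2 ≤ s * ∑ j ∈ S, v j ^ 2 :=
      h1.trans (mul_le_mul_of_nonneg_right (by exact_mod_cast hS)
        (Finset.sum_nonneg fun j _ => sq_nonneg _))
    rw [hw, ← Real.sqrt_mul (Nat.cast_nonneg s)]
    exact Real.le_sqrt_of_sq_le h2
  have hDl : D ≤ Real.sqrt s * w / ρ := by
    rw [le_div_iff₀ hρ]
    have : ρ / Real.sqrt s * D * Real.sqrt s ≤ w * Real.sqrt s :=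
      mul_le_mul_of_nonneg_right hw1.le hs0.le
    have e : ρ / Real.sqrt s * D * Real.sqrt s = D * ρ := by field_simp
    linarith
  have hsum : ∑ j, |v j| ≤ 2 * Real.sqrt s / ρ * N := by
    rw [← Finset.sum_add_sum_compl S]
    have h1 : Real.sqrt s * w ≤ Real.sqrt s * w / ρ := by
      rw [le_div_iff₀ hρ]
      exact mul_le_of_le_one_right (by positivity) hρ1.le
    calc ∑ j ∈ S, |v j| + ∑ j ∈ Sᶜ, |v j| ≤ 2 * Real.sqrt s / ρ * w := by
          have e : 2 * Real.sqrt s / ρ * w = Real.sqrt s * w / ρ + Real.sqrt s * w / ρ := by ring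
          rw [e]
          exact add_le_add (hSl.trans h1) hDl
      _ ≤ _ := mul_le_mul_of_nonneg_left hwN (by positivity)
  have h := hB (fun j => v j / N) ?_ ?_
  · have hmul : ∀ i, (B.mulVec fun j => v j / N) i = (B.mulVec v) i / N := fun i => by
      simp only [Matrix.mulVec, dotProduct]
      rw [Finset.sum_div]
      exact Finset.sum_congr rfl fun j _ => (mul_div_assoc _ _ _).symm
    simp only [hmul, div_pow] at h
    rw [← Finset.sum_div, div_le_div_iff₀ (by positivity) (by positivity), one_mul] at h
    have h2 : N ≤ τ * b := by
      have e : τ * b = Real.sqrt ((∑ i, (B.mulVec v) i ^ 2) * τ ^ 2) := by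
        rw [Real.sqrt_mul' _ (sq_nonneg τ), Real.sqrt_sq hτ.le, mul_comm]
      rw [e]
      exact Real.le_sqrt_of_sq_le h
    have h3 : 0 ≤ ρ / Real.sqrt s * D := by positivity
    linarith
  · simp only [div_pow]
    rw [← Finset.sum_div, ← hN2, div_self (by positivity)]
  · simp only [abs_div, abs_of_pos hNpos]
    rw [← Finset.sum_div, div_le_iff₀ hNpos]
    exact hsum

end NullSpaceProperty

/-! ### From finite sets of points to a separable index space. -/

section Separable

variable {Ω : Type*} [MeasurableSpace Ω] {P : Measure Ω} [IsProbabilityMeasure P]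

/-- A lower bound for a continuous process that holds with uniform probability on all finite sets
of points holds on a separable index space. -/
lemma measureReal_forall_of_finite {E : Type*} [TopologicalSpace E]
    [TopologicalSpace.SeparableSpace E] {g : Ω → E → ℝ} (hgc : ∀ ω, Continuous (g ω))
    (hgm : ∀ x, Measurable fun ω => g ω x) {θ p : ℝ} (hp : 0 ≤ p)
    (h : ∀ (N : ℕ) (x : Fin (N + 1) → E), P.real {ω | ∃ i, g ω (x i) < θ} ≤ p) :
    1 - p ≤ P.real {ω | ∀ x, θ ≤ g ω x} := by
  rcases isEmpty_or_nonempty E with hE | hE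
  · have : {ω | ∀ x, θ ≤ g ω x} = Set.univ := Set.eq_univ_of_forall fun ω x => hE.elim x
    rw [this, probReal_univ]
    linarith
  obtain ⟨u, hu⟩ := TopologicalSpace.exists_dense_seq E
  set s : ℕ → Set Ω := fun N => {ω | ∀ i ≤ N, θ ≤ g ω (u i)} with hs
  have hsm : ∀ N, MeasurableSet (s N) := fun N => by
    have : s N = ⋂ i, ⋂ _ : i ≤ N, {ω | θ ≤ g ω (u i)} := by ext ω; simp [hs]
    rw [this]
    exact MeasurableSet.iInter fun i => MeasurableSet.iInter fun _ =>
      measurableSet_le measurable_const (hgm _)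
  have hanti : Antitone s := fun a b hab ω hω i hi => hω i (hi.trans hab)
  have hlim := tendsto_measure_iInter_atTop (μ := P) (fun N => (hsm N).nullMeasurableSet) hanti
    ⟨0, measure_ne_top _ _⟩
  have hlim' := (ENNReal.tendsto_toReal (measure_ne_top P (⋂ N, s N))).comp hlim
  have hge : ∀ N, 1 - p ≤ P.real (s N) := fun N => by
    have h1 := h N fun i => u i
    have h2 : (s N)ᶜ ⊆ {ω | ∃ i : Fin (N + 1), g ω (u i) < θ} := by
      intro ω hω
      have : ¬ ∀ i ≤ N, θ ≤ g ω (u i) := hω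
      push Not at this
      obtain ⟨i, hi, hlt⟩ := this
      exact ⟨⟨i, by omega⟩, hlt⟩
    have h3 := (measureReal_mono h2 (μ := P)).trans h1
    rw [measureReal_compl (hsm N), probReal_univ] at h3
    linarith
  have hle : 1 - p ≤ P.real (⋂ N, s N) := ge_of_tendsto' hlim' hge
  -- Only monotonicity is used, so the event over all points need not be shown measurable.
  refine hle.trans (measureReal_mono fun ω hω => ?_)
  have hω' : ∀ i, θ ≤ g ω (u i) := fun i => Set.mem_iInter.1 hω i i le_rfl
  intro x
  have hcl : IsClosed {x | θ ≤ g ω x} := isClosed_le continuous_const (hgc ω)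
  exact hu.induction_on (p := fun x => θ ≤ g ω x) x hcl hω'

end Separable

/-! ### Probability bounds for a matrix with controlled entries. -/

section IndependentEntries

variable {Ω : Type*} [MeasurableSpace Ω] {P : Measure Ω} {m n : ℕ}

/-- Independent entries with a common variance `v`, third and fourth central moments bounded by
`m₃` and `m₄`, and `cosh` moments bounded at the scale `L`. -/
structure EntryBounds (A : Ω → Matrix (Fin m) (Fin n) ℝ) (P : Measure Ω) (v m₃ m₄ L : ℝ) :
    Prop where
  measurable : ∀ i j, Measurable fun ω => A ω i j
  indep : iIndepFun (fun (e : Fin m × Fin n) (ω : Ω) => A ω e.1 e.2) P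
  scale_pos : 0 < L
  cosh_le : ∀ i j, ∫⁻ ω, ENNReal.ofReal (Real.cosh (A ω i j / L)) ∂P ≤ 2
  var_pos : 0 < v
  moment_two : ∀ i j, centralMoment (fun ω => A ω i j) 2 P = v
  moment_three : ∀ i j, |centralMoment (fun ω => A ω i j) 3 P| ≤ m₃
  moment_four : ∀ i j, |centralMoment (fun ω => A ω i j) 4 P| ≤ m₄

variable {A : Ω → Matrix (Fin m) (Fin n) ℝ} {v m₃ m₄ L : ℝ}

lemma EntryBounds.memLp (h : EntryBounds A P v m₃ m₄ L) (i : Fin m) (j : Fin n) :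
    MemLp (fun ω => A ω i j) 4 P :=
  memLp_four_of_cosh h.scale_pos (h.measurable i j) (h.cosh_le i j)

lemma EntryBounds.measurable_row (h : EntryBounds A P v m₃ m₄ L) (i : Fin m) :
    Measurable fun ω => A ω i :=
  measurable_pi_lambda _ fun j => h.measurable i j

lemma EntryBounds.measurable_mulVec (h : EntryBounds A P v m₃ m₄ L) (x : Fin n → ℝ) (i : Fin m) :
    Measurable fun ω => (A ω).mulVec x i :=
  Finset.measurable_sum Finset.univ fun j _ => (h.measurable i j).mul_const (x j)

variable [IsProbabilityMeasure P]

lemma EntryBounds.sq_var_le (h : EntryBounds A P v m₃ m₄ L) (i : Fin m) (j : Fin n) :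
    v ^ 2 ≤ m₄ := by
  have h1 := sq_integral_sq_le (P := P) (Z := fun ω => A ω i j - ∫ ω, A ω i j ∂P)
    ((h.memLp i j).sub (memLp_const _))
  have h2 := h.moment_two i j
  have h4 := (le_abs_self _).trans (h.moment_four i j)
  simp only [centralMoment, Pi.pow_apply, Pi.sub_apply] at h2 h4
  rw [h2] at h1
  exact h1.trans h4

/-- Compares variance with scale. It shows that the `ψ_k`-norm is positive, and it turns the row
condition into a bound of `m` by `log n` free of moments. -/
lemma EntryBounds.var_le (h : EntryBounds A P v m₃ m₄ L) (i : Fin m) (j : Fin n) :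
    v ≤ 2 * L ^ 2 := by
  rw [← h.moment_two i j, centralMoment_two_eq_variance (h.measurable i j).aemeasurable]
  refine (variance_le_expectation_sq (h.measurable i j).aestronglyMeasurable).trans ?_
  exact integral_sq_le_of_cosh h.scale_pos (h.measurable i j) (h.cosh_le i j)

lemma EntryBounds.iIndepFun_row (h : EntryBounds A P v m₃ m₄ L) :
    iIndepFun (fun i ω => A ω i) P :=
  iIndepFun.curry (X := fun i j ω => A ω i j) h.measurable h.indep

lemma EntryBounds.smallBall (h : EntryBounds A P v m₃ m₄ L) {K : ℝ}
    (hK : v ^ 2 + m₃ + v * m₃ + m₄ ≤ K) (i : Fin m) {x : Fin n → ℝ} (hx : ∑ j, x j ^ 2 = 1) :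
    0.65 * (v ^ 2 / K) ≤ P.real {ω | Real.sqrt v / 10 ≤ |(A ω).mulVec x i|} :=
  smallBall_of_iIndepFun (X := fun j ω => A ω i j)
    (h.indep.precomp (g := fun j : Fin n => (i, j)) (Prod.mk_right_injective i))
    (h.measurable i) (h.memLp i) hx h.var_pos (h.moment_two i) (h.moment_three i)
    (h.moment_four i) hK

/-- A lower bound for the image of a single unit vector, valid for every number of rows. -/
lemma EntryBounds.measureReal_sum_sq_lt_le (h : EntryBounds A P v m₃ m₄ L) {K : ℝ}
    (hK : v ^ 2 + m₃ + v * m₃ + m₄ ≤ K) (hK2 : 2 * v ^ 2 ≤ K) {x : Fin n → ℝ}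
    (hx : ∑ j, x j ^ 2 = 1) :
    P.real {ω | ∑ i, ((A ω).mulVec x i) ^ 2 < v / 100 * (m * (v ^ 2 / K) ^ 2 / 20)} ≤
      Real.exp (-(m * (v ^ 2 / K) ^ 2)) := by
  set r := v ^ 2 / K with hr
  have hv := h.var_pos
  have hKpos : 0 < K := lt_of_lt_of_le (by positivity) hK2
  have hr0 : 0 < r := by positivity
  have hr2 : r ≤ 1 / 2 := by rw [hr, div_le_iff₀ hKpos]; linarith
  set I : Set ℝ := {z | Real.sqrt v / 10 ≤ |z|} with hI
  have hIm : MeasurableSet I := measurableSet_le measurable_const measurable_id.abs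
  set X : Fin m → Ω → ℝ := fun i ω => I.indicator (fun _ => (1 : ℝ)) ((A ω).mulVec x i) with hX
  have hmv : ∀ i, Measurable fun ω => (A ω).mulVec x i := h.measurable_mulVec x
  have hXm : ∀ i, Measurable (X i) := fun i => (measurable_const.indicator hIm).comp (hmv i)
  have hXind : iIndepFun X P := by
    refine h.iIndepFun_row.comp
      (fun _ w => I.indicator (fun _ => (1 : ℝ)) (∑ j, w j * x j)) fun i => ?_
    exact (measurable_const.indicator hIm).comp (by fun_prop)
  -- Chernoff at `-3`: since `exp(-3) ≤ 0.05`, one indicator of probability at least `0.65 r`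
  -- contributes the factor `1 - 0.95 · 0.65 r`.
  have hmgf : ∀ i, mgf (X i) P (-3) ≤ Real.exp (-(0.95 * (0.65 * r))) := by
    intro i
    set E : Set Ω := {ω | Real.sqrt v / 10 ≤ |(A ω).mulVec x i|} with hE
    have hEm : MeasurableSet E := measurableSet_le measurable_const (hmv i).abs
    have hEr : 0.65 * r ≤ P.real E := h.smallBall hK i hx
    have e : ∀ ω, Real.exp (-3 * X i ω) =
        1 - (1 - Real.exp (-3)) * E.indicator (fun _ => (1 : ℝ)) ω := by
      intro ω
      by_cases hω : ω ∈ E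
      · have hω' : (A ω).mulVec x i ∈ I := hω
        simp only [hX]
        rw [Set.indicator_of_mem hω, Set.indicator_of_mem hω']
        ring_nf
      · have hω' : (A ω).mulVec x i ∉ I := hω
        simp only [hX]
        rw [Set.indicator_of_notMem hω, Set.indicator_of_notMem hω']
        simp
    have h3 : Real.exp (-3) ≤ 0.05 := by
      rw [Real.exp_neg, inv_le_comm₀ (Real.exp_pos _) (by norm_num)]
      have h1 := Real.exp_one_gt_d9
      have h2 : Real.exp 3 = Real.exp 1 ^ 3 := by rw [← Real.exp_nat_mul]; norm_num
      rw [h2]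
      calc (0.05 : ℝ)⁻¹ ≤ 2.7182818283 ^ 3 := by norm_num
        _ ≤ _ := pow_le_pow_left₀ (by norm_num) h1.le 3
    rw [mgf]
    simp only [e]
    rw [integral_sub (integrable_const _) (((integrable_const _).indicator hEm).const_mul _),
      integral_const_mul, integral_indicator_const _ hEm]
    simp only [integral_const, probReal_univ, smul_eq_mul, mul_one]
    refine le_trans ?_ (Real.add_one_le_exp _)
    nlinarith
  have hsum : mgf (∑ i, X i) P (-3) ≤ Real.exp (-(0.95 * (0.65 * r)) * m) := by
    rw [hXind.mgf_sum hXm]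
    refine (Finset.prod_le_prod (fun i _ => mgf_nonneg) fun i _ => hmgf i).trans ?_
    rw [Finset.prod_const, Finset.card_univ, Fintype.card_fin, ← Real.exp_nat_mul, mul_comm]
  have hsub : {ω | ∑ i, ((A ω).mulVec x i) ^ 2 < v / 100 * (m * r ^ 2 / 20)} ⊆
      {ω | (∑ i, X i) ω ≤ m * r ^ 2 / 20} := by
    intro ω hω
    have hω : ∑ i, ((A ω).mulVec x i) ^ 2 < v / 100 * (m * r ^ 2 / 20) := hω
    have h1 : v / 100 * ∑ i, X i ω ≤ ∑ i, ((A ω).mulVec x i) ^ 2 := by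
      rw [Finset.mul_sum]
      refine Finset.sum_le_sum fun i _ => ?_
      simp only [hX]
      by_cases hi : (A ω).mulVec x i ∈ I
      · rw [Set.indicator_of_mem hi, mul_one]
        have h2 : Real.sqrt v / 10 ≤ |(A ω).mulVec x i| := hi
        have h3 := pow_le_pow_left₀ (by positivity) h2 2
        rw [sq_abs, div_pow, Real.sq_sqrt hv.le] at h3
        linarith
      · rw [Set.indicator_of_notMem hi, mul_zero]
        exact sq_nonneg _
    change (∑ i, X i) ω ≤ _
    rw [Finset.sum_apply]
    exact (lt_of_mul_lt_mul_left (h1.trans_lt hω) (by positivity)).le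
  refine (measureReal_mono hsub).trans ?_
  have hint : Integrable (fun ω => Real.exp (-3 * (∑ i, X i) ω)) P := by
    refine Integrable.of_bound (C := 1) ?_ (Filter.Eventually.of_forall fun ω => ?_)
    · simp only [Finset.sum_apply]
      exact (Real.measurable_exp.comp
        ((Finset.measurable_sum Finset.univ fun i _ => hXm i).const_mul (-3))).aestronglyMeasurable
    · rw [Real.norm_eq_abs, abs_of_pos (Real.exp_pos _), Real.exp_le_one_iff, Finset.sum_apply]
      have : 0 ≤ ∑ i, X i ω := Finset.sum_nonneg fun i _ =>
        Set.indicator_nonneg (fun _ _ => zero_le_one) _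
      linarith
  refine (measure_le_le_exp_mul_mgf (X := ∑ i, X i) (μ := P) (m * r ^ 2 / 20) (t := -3)
    (by norm_num) hint).trans ?_
  refine (mul_le_mul_of_nonneg_left hsum (Real.exp_pos _).le).trans ?_
  rw [← Real.exp_add]
  refine Real.exp_le_exp.2 ?_
  have hm0 : (0 : ℝ) ≤ m := Nat.cast_nonneg m
  -- The exponent needs `(1 + 3/20) r^2 ≤ 0.6175 r`, which holds because `r ≤ 1/2`.
  have h1 : r * r ≤ 1 / 2 * r := mul_le_mul_of_nonneg_right hr2 hr0.le
  have h2 := mul_le_mul_of_nonneg_left h1 hm0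
  nlinarith

/-- A uniform lower bound over finitely many unit vectors of bounded `ℓ₁`-norm. -/
lemma EntryBounds.measureReal_exists_sum_sq_lt_le (h : EntryBounds A P v m₃ m₄ L) {K : ℝ}
    (hK : v ^ 2 + m₃ + v * m₃ + m₄ ≤ K) (hK2 : 2 * v ^ 2 ≤ K) (hn : 0 < n) {M : ℕ} (hM : 0 < M)
    (hMm : M * 2 ≤ m) {T : Type*} [Fintype T] [Nonempty T] (x : T → Fin n → ℝ)
    (hx : ∀ t, ∑ j, x t j ^ 2 = 1) {R : ℝ} (hR : ∀ t, ∑ j, |x t j| ≤ R) {c u a : ℝ}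
    (hc : 0 < c) (hcL : c * L ≤ 1) (hu : 0 ≤ u) (ha : 0 ≤ a)
    (hbound : a ≤ M * (0.65 * (v ^ 2 / K) * (2 - 0.65 * (v ^ 2 / K)))
      - 2 * R / (c * (Real.sqrt v / 10))
        * Real.log (2 * n * Real.exp ((c * L) ^ 2) ^ (2 * M)) - M * u) :
    P.real {ω | ∃ t, ∑ i, ((A ω).mulVec (x t) i) ^ 2 < v / 100 * a ^ 2 / M} ≤
      Real.exp (-(2 * M * u ^ 2)) := by
  set η := Real.sqrt v / 10 with hη
  have hv := h.var_pos
  have hη0 : 0 < η := by positivity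
  have hη2 : η ^ 2 = v / 100 := by rw [hη, div_pow, Real.sq_sqrt hv.le]; norm_num
  have hKpos : 0 < K := lt_of_lt_of_le (by positivity) hK2
  have hr2 : v ^ 2 / K ≤ 1 / 2 := by rw [div_le_iff₀ hKpos]; linarith
  -- Disjoint pairs of rows; rows beyond the first `2M` are discarded.
  set f : Fin M × Fin 2 → Fin m := fun p => Fin.castLE hMm (finProdFinEquiv p) with hf
  have hfinj : Function.Injective f := (Fin.castLE_injective hMm).comp finProdFinEquiv.injective
  set ρ : Fin m → Measure (Fin n → ℝ) := fun i => P.map fun ω => A ω i with hρ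
  have hρp : ∀ i, IsProbabilityMeasure (ρ i) := fun i =>
    Measure.isProbabilityMeasure_map (h.measurable_row i).aemeasurable
  have hrows : iIndepFun (fun (p : Fin M × Fin 2) ω => A ω (f p)) P :=
    h.iIndepFun_row.precomp hfinj
  set Y : Fin M → Ω → (Fin n → ℝ) × (Fin n → ℝ) := fun b ω => (A ω (f (b, 0)), A ω (f (b, 1)))
    with hY
  have hYm : ∀ b, Measurable (Y b) := fun b =>
    (h.measurable_row _).prodMk (h.measurable_row _)
  have hYind : iIndepFun Y P :=
    (iIndepFun.curry (X := fun b l ω => A ω (f (b, l)))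
      (fun b l => h.measurable_row _) hrows).comp (fun _ w => (w 0, w 1)) fun _ => by fun_prop
  have hYlaw : ∀ b, P.map (Y b) = (ρ (f (b, 0))).prod (ρ (f (b, 1))) := fun b =>
    (indepFun_iff_map_prod_eq_prod_map_map (h.measurable_row _).aemeasurable
      (h.measurable_row _).aemeasurable).1
      (hrows.indepFun (i := (b, 0)) (j := (b, 1)) (by simp))
  have hjoint := (iIndepFun_iff_map_fun_eq_pi_map fun b => (hYm b).aemeasurable).1 hYind
  simp only [hYlaw] at hjoint
  have hint : ∀ i j, Integrable (fun w : Fin n → ℝ => w j) (ρ i) := fun i j => by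
    rw [hρ, integrable_map_measure (measurable_pi_apply j).aestronglyMeasurable
      (h.measurable_row i).aemeasurable]
    exact (h.memLp i j).integrable (by norm_num)
  have hexp : ∀ i j, ∫⁻ w, ENNReal.ofReal (Real.exp (c * w j)) ∂(ρ i)
      + ∫⁻ w, ENNReal.ofReal (Real.exp (-c * w j)) ∂(ρ i)
      ≤ 2 * ENNReal.ofReal (Real.exp ((c * L) ^ 2)) := fun i j => by
    have hm : ∀ d : ℝ, Measurable fun w : Fin n → ℝ => ENNReal.ofReal (Real.exp (d * w j)) :=
      fun d => by fun_prop
    rw [hρ, lintegral_map (hm c) (h.measurable_row i),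
      lintegral_map (hm (-c)) (h.measurable_row i)]
    refine lintegral_exp_add_lintegral_exp_neg_le h.scale_pos (h.measurable i j)
      (h.cosh_le i j) ?_
    rwa [abs_of_pos (mul_pos hc h.scale_pos)]
  have hball : ∀ i t, 0.65 * (v ^ 2 / K) ≤ (ρ i).real {w | η ≤ |∑ j, w j * x t j|} := fun i t => by
    rw [hρ, map_measureReal_apply (h.measurable_row i)
      (measurableSet_le measurable_const (by fun_prop))]
    exact h.smallBall hK i (hx t)
  have hcore := measureReal_exists_sum_pairResponse_le hn hM (fun b => ρ (f (b, 0)))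
    (fun b => ρ (f (b, 1))) (fun b j => hint _ j) (fun b j => hint _ j) hc
    (Real.exp_pos ((c * L) ^ 2)) hη0 (fun b j => hexp _ j) (fun b j => hexp _ j) x hR
    (q := 0.65 * (v ^ 2 / K)) (by linarith) (fun b t => hball _ t) (fun b t => hball _ t) hu hbound
  rw [← hjoint, map_measureReal_apply (measurable_pi_lambda _ hYm)] at hcore
  · refine (measureReal_mono ?_).trans hcore
    rintro ω ⟨t, ht⟩
    refine ⟨t, ?_⟩
    have h1 := sq_sum_pairResponse_le hη0 (A ω) (x t) f hfinj
    have hMpos : (0 : ℝ) < M := by exact_mod_cast hM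
    rw [lt_div_iff₀ hMpos, ← hη2] at ht
    have h2 : η ^ 2 * (∑ b, pairResponse η (A ω (f (b, 0)), A ω (f (b, 1))) (x t)) ^ 2
        < η ^ 2 * a ^ 2 := by
      refine h1.trans_lt ?_
      rwa [mul_comm]
    exact (lt_of_pow_lt_pow_left₀ 2 ha (lt_of_mul_lt_mul_left h2 (by positivity))).le
  · have : {y : Fin M → (Fin n → ℝ) × (Fin n → ℝ) | ∃ t, ∑ b, pairResponse η (y b) (x t) ≤ a}
        = ⋃ t, {y | ∑ b, pairResponse η (y b) (x t) ≤ a} := by ext y; simp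
    rw [this]
    exact MeasurableSet.iUnion fun t => measurableSet_le (Finset.measurable_sum _ fun b _ =>
      (measurable_pairResponse η (x t)).comp (measurable_pi_apply b)) measurable_const

end IndependentEntries

/-! ### Choice of constants and assembly. -/

section MainTheorem

lemma rpow_five_halves {v : ℝ} (hv : 0 < v) : v ^ (5 / 2 : ℝ) = v ^ 2 * Real.sqrt v := by
  rw [Real.sqrt_eq_rpow, ← Real.rpow_natCast v 2, ← Real.rpow_add hv]
  norm_num

/-- The two consequences of the lower bound on the number of rows. -/
lemma row_count_consequences {K v τ ρ ψ S m : ℝ} (hv : 0 < v) (hK : 0 < K) (hτ : 0 < τ)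
    (hρ : 0 < ρ) (hψ : 0 ≤ ψ) (hS : 0 ≤ S)
    (h : 10 ^ 10 * (K / (v ^ (5 / 2 : ℝ) * τ) * (1 + τ * ρ⁻¹ * ψ * Real.sqrt S)) ^ 2 ≤ m) :
    10 ^ 10 * (1 / τ ^ 2) ≤ (v ^ 2 / K) ^ 2 * v * m ∧
    10 ^ 10 * (ψ ^ 2 * S / ρ ^ 2) ≤ (v ^ 2 / K) ^ 2 * v * m := by
  set σ := Real.sqrt v with hσ
  have hσ0 : 0 < σ := Real.sqrt_pos.2 hv
  have hσv : σ ^ 2 = v := Real.sq_sqrt hv.le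
  set q := ρ⁻¹ * ψ * Real.sqrt S with hq
  have hq0 : 0 ≤ q := by positivity
  have hq2 : q ^ 2 = ψ ^ 2 * S / ρ ^ 2 := by
    rw [hq, mul_pow, mul_pow, Real.sq_sqrt hS, inv_pow]; field_simp
  -- The row condition reads `10^10 (1/τ + q)^2 ≤ r^2 v m` with `r = v^2/K`; dropping either summand
  -- gives the two conclusions.
  have e : (K / (v ^ (5 / 2 : ℝ) * τ) * (1 + τ * ρ⁻¹ * ψ * Real.sqrt S)) ^ 2
      = (1 / τ + q) ^ 2 / ((v ^ 2 / K) ^ 2 * v) := by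
    rw [rpow_five_halves hv, ← hσ, hq]
    have h1 : K / (v ^ 2 * σ * τ) * (1 + τ * ρ⁻¹ * ψ * Real.sqrt S)
        = (1 / τ + ρ⁻¹ * ψ * Real.sqrt S) / ((v ^ 2 / K) * σ) := by field_simp
    rw [h1, div_pow, mul_pow, hσv]
  have hpos : 0 < (v ^ 2 / K) ^ 2 * v := by positivity
  rw [e, ← mul_div_assoc, div_le_iff₀ hpos] at h
  have hτ0 : 0 < 1 / τ := by positivity
  have hmul : 0 ≤ 1 / τ * q := by positivity
  have e2 : 1 / τ ^ 2 = (1 / τ) ^ 2 := by rw [one_div_pow]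
  rw [e2, ← hq2]
  constructor <;> nlinarith [sq_nonneg q, sq_nonneg (1 / τ)]

variable {Ω : Type*} [MeasurableSpace Ω] {P : Measure Ω} {m n : ℕ}
  {A : Ω → Matrix (Fin m) (Fin n) ℝ}

lemma abs_centralMoment_le_matrixCentralMoment (p : ℕ) (i : Fin m) (j : Fin n) :
    |centralMoment (fun ω => A ω i j) p P| ≤ matrixCentralMoment p A P :=
  le_ciSup (f := fun e : Fin m × Fin n => |centralMoment (fun ω => A ω e.1 e.2) p P|)
    (Set.finite_range _).bddAbove (i, j)

lemma nonempty_of_matrixCentralMoment_pos {p : ℕ} (h : 0 < matrixCentralMoment p A P) :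
    Nonempty (Fin m × Fin n) := by
  by_contra hne
  rw [not_nonempty_iff] at hne
  rw [matrixCentralMoment, Real.iSup_of_isEmpty] at h
  exact h.false

lemma centralMoment_two_eq_matrixCentralMoment (hcen : IsCentral 2 A P) (i : Fin m) (j : Fin n) :
    centralMoment (fun ω => A ω i j) 2 P = matrixCentralMoment 2 A P := by
  have h0 : 0 ≤ centralMoment (fun ω => A ω i j) 2 P :=
    integral_nonneg fun ω => by simp only [Pi.pow_apply]; positivity
  have : Nonempty (Fin m × Fin n) := ⟨(i, j)⟩
  rw [matrixCentralMoment]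
  have e : ∀ e : Fin m × Fin n, |centralMoment (fun ω => A ω e.1 e.2) 2 P|
      = centralMoment (fun ω => A ω i j) 2 P := fun e => by
    rw [hcen 2 (by norm_num) le_rfl e.1 i e.2 j, abs_of_nonneg h0]
  simp only [e, ciSup_const]

/-- The choice of parameters in the uniform lower bound. -/
lemma uniform_bound_parameters {r v ψ ρ s l L m : ℝ} {M : ℕ} {n : ℕ} (hn : 2 ≤ n) (hv : 0 < v)
    (hr0 : 0 < r) (hr : r ≤ 1 / 2) (hρ : 0 < ρ) (hs : 1 ≤ s) (hψ : 0 < ψ) (hL : L = 2 * ψ)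
    (hl : l = Real.log (2 * n)) (hM : 0 < M) (hmM : m ≤ 3 * M) (hlM : l ≤ 2 * M)
    (h : 10 ^ 10 * (ψ ^ 2 * (s * Real.log n) / ρ ^ 2) ≤ r ^ 2 * v * m) :
    0 < Real.sqrt (l / (2 * M)) / L ∧ Real.sqrt (l / (2 * M)) / L * L ≤ 1 ∧
    0.02 * r * M ≤ M * (0.65 * r * (2 - 0.65 * r))
      - 2 * (2 * Real.sqrt s / ρ) / (Real.sqrt (l / (2 * M)) / L * (Real.sqrt v / 10))
        * Real.log (2 * n * Real.exp ((Real.sqrt (l / (2 * M)) / L * L) ^ 2) ^ (2 * M))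
      - M * (1.05 * r) := by
  have hn' : (2 : ℝ) ≤ n := by exact_mod_cast hn
  have hM' : (0 : ℝ) < M := by exact_mod_cast hM
  have hlog2 : 0 < Real.log n := Real.log_pos (by linarith)
  have hl0 : 0 < l := by rw [hl]; exact Real.log_pos (by linarith)
  have hl2 : l ≤ 2 * Real.log n := by
    rw [hl, Real.log_mul (by norm_num) (by linarith), two_mul]
    exact add_le_add (Real.log_le_log (by norm_num) hn') le_rfl
  have hLpos : 0 < L := by rw [hL]; positivity
  -- With `c L = d` the supremum bound is proportional to `(l + 2 M d^2)/d`, minimal when the two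
  -- terms agree. Then the logarithm equals `2l`, and `l ≤ 2M` keeps `d ≤ 1`.
  set d := Real.sqrt (l / (2 * M)) with hd
  have hd0 : 0 < d := Real.sqrt_pos.2 (by positivity)
  have hd2 : d ^ 2 = l / (2 * M) := Real.sq_sqrt (by positivity)
  have hdL : d / L * L = d := div_mul_cancel₀ _ hLpos.ne'
  have hd1 : d ≤ 1 := by
    refine Real.sqrt_le_iff.2 ⟨zero_le_one, ?_⟩
    rw [one_pow]
    exact (div_le_one (by positivity)).2 hlM
  refine ⟨by positivity, by rw [hdL]; exact hd1, ?_⟩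
  have hlogval : Real.log (2 * n * Real.exp ((d / L * L) ^ 2) ^ (2 * M)) = 2 * l := by
    rw [Real.log_mul (by positivity) (by positivity), Real.log_pow, Real.log_exp, hdL, hd2, ← hl]
    push_cast
    field_simp
    ring
  rw [hlogval]
  set W := 2 * (2 * Real.sqrt s / ρ) / (d / L * (Real.sqrt v / 10)) * (2 * l) with hW
  have hW2 : W ^ 2 ≤ (0.01 * r * M) ^ 2 := by
    have e : W ^ 2 = 12800 * (s / ρ ^ 2) * L ^ 2 * M * l / v := by
      have e1 : W = 80 * Real.sqrt s * L * l / (ρ * d * Real.sqrt v) := by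
        rw [hW]
        have := Real.sqrt_pos.2 hv
        field_simp
        ring
      rw [e1]
      simp only [div_pow, mul_pow]
      rw [Real.sq_sqrt (by linarith), Real.sq_sqrt hv.le, hd2]
      field_simp
      ring
    rw [e, div_le_iff₀ hv, hL]
    have h1 : 12800 * (s / ρ ^ 2) * (2 * ψ) ^ 2 * M * l ≤
        12800 * (s / ρ ^ 2) * (2 * ψ) ^ 2 * M * (2 * Real.log n) :=
      mul_le_mul_of_nonneg_left hl2 (by positivity)
    refine h1.trans ?_
    have h2 : 12800 * (s / ρ ^ 2) * (2 * ψ) ^ 2 * M * (2 * Real.log n)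
        = 102400 * M * (ψ ^ 2 * (s * Real.log n) / ρ ^ 2) := by ring
    rw [h2]
    have h3 : ψ ^ 2 * (s * Real.log n) / ρ ^ 2 ≤ r ^ 2 * v * (3 * M) / 10 ^ 10 := by
      rw [le_div_iff₀ (by norm_num)]
      have : r ^ 2 * v * m ≤ r ^ 2 * v * (3 * M) := mul_le_mul_of_nonneg_left hmM (by positivity)
      linarith
    -- This fixes the size of the constant: `3 · 102400 / 10^10` must not exceed `0.01^2`.
    refine (mul_le_mul_of_nonneg_left h3 (by positivity)).trans ?_
    have h4 : 0 ≤ r ^ 2 * v * (M : ℝ) ^ 2 := by positivity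
    nlinarith
  have hWle : W ≤ 0.01 * r * M := le_of_sq_le_sq hW2 (by positivity)
  -- By `r ≤ 1/2`, `q(2 - q) ≥ (1.3 - 0.65^2/2) r > 1.08 r`; removing `1.05 r` for the deviation and
  -- `0.01 r` for `W` leaves at least `0.02 r` per pair.
  have h5 : r * r ≤ 1 / 2 * r := mul_le_mul_of_nonneg_right hr hr0.le
  have h6 := mul_le_mul_of_nonneg_left h5 hM'.le
  nlinarith

/-- The strict inequality `matrixPsiNorm k A P < L` provides for every entry an admissible scale
below `L`. -/
lemma entryBounds_of_psiNorm {k : ℕ} (hk : k = 1 ∨ k = 2)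
    (hA : ∀ i j, Measurable fun ω => A ω i j)
    (hind : iIndepFun (fun (e : Fin m × Fin n) (ω : Ω) => A ω e.1 e.2) P)
    (hpsi : ∀ i j, HasFinitePsiNorm k (fun ω => A ω i j) P) (hcen : IsCentral 2 A P)
    (hvar : 0 < matrixCentralMoment 2 A P) {L : ℝ} (hL0 : 0 < L) (hL : matrixPsiNorm k A P < L) :
    EntryBounds A P (matrixCentralMoment 2 A P) (matrixCentralMoment 3 A P)
      (matrixCentralMoment 4 A P) L where
  measurable := hA
  indep := hind
  scale_pos := hL0
  cosh_le i j := by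
    have hle : psiNorm k (fun ω => A ω i j) P ≤ matrixPsiNorm k A P :=
      le_ciSup (f := fun e : Fin m × Fin n => psiNorm k (fun ω => A ω e.1 e.2) P)
        (Set.finite_range _).bddAbove (i, j)
    obtain ⟨t₀, ht₀, hle₀⟩ := exists_mem_psiScales_le_of_lt (hpsi i j) (hle.trans_lt hL)
    exact lintegral_cosh_div_le_two hk ht₀ hle₀
  var_pos := hvar
  moment_two := centralMoment_two_eq_matrixCentralMoment hcen
  moment_three := abs_centralMoment_le_matrixCentralMoment 3
  moment_four := abs_centralMoment_le_matrixCentralMoment 4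

variable [IsProbabilityMeasure P] {v m₃ m₄ K ψ ρ τ : ℝ} {s : ℕ}

/-- The finite-dimensional lower bound in the case of a single column. -/
lemma EntryBounds.measureReal_exists_lt_le_of_eq_one {L : ℝ} (hB : EntryBounds A P v m₃ m₄ L)
    (hK : v ^ 2 + m₃ + v * m₃ + m₄ ≤ K) (hK2 : 2 * v ^ 2 ≤ K) (hn : n = 1)
    (h : 10 ^ 10 * (1 / τ ^ 2) ≤ (v ^ 2 / K) ^ 2 * v * m) {T : Type*} (x : T → Fin n → ℝ)
    (hx : ∀ t, ∑ j, x t j ^ 2 = 1) :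
    P.real {ω | ∃ t, ∑ i, ((A ω).mulVec (x t) i) ^ 2 < 1 / τ ^ 2} ≤
      Real.exp (-(m * (v ^ 2 / K) ^ 2)) := by
  subst hn
  refine (measureReal_mono ?_).trans
    (hB.measureReal_sum_sq_lt_le hK hK2 (x := fun _ => 1) (by simp))
  rintro ω ⟨t, ht⟩
  have h1 := hx t
  rw [Fin.sum_univ_one] at h1
  have e : ∀ i, ((A ω).mulVec (x t) i) ^ 2 = ((A ω).mulVec (fun _ => 1) i) ^ 2 := fun i => by
    simp [Matrix.mulVec, dotProduct, mul_pow, h1]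
  simp only [e] at ht
  refine lt_of_lt_of_le ht ?_
  have := hB.var_pos
  have hnn : 0 ≤ (v ^ 2 / K) ^ 2 * v * m := by positivity
  have e2 : v / 100 * (m * (v ^ 2 / K) ^ 2 / 20) = (v ^ 2 / K) ^ 2 * v * m / 2000 := by ring
  rw [e2]
  linarith

/-- The row count is large compared to the logarithm of the number of columns. -/
lemma log_le_of_row_count {r m : ℝ} (hv : 0 < v) (hr0 : 0 < r) (hr : r ≤ 1 / 2) (hρ : 0 < ρ)
    (hρ1 : ρ < 1) (hs : 1 ≤ s) (hvψ : v ≤ 2 * ψ ^ 2) (hm : 0 ≤ m)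
    (h : 10 ^ 10 * (ψ ^ 2 * (s * Real.log n) / ρ ^ 2) ≤ r ^ 2 * v * m) :
    1000 * Real.log n ≤ m := by
  have hs' : (1 : ℝ) ≤ s := by exact_mod_cast hs
  have hlog0 : 0 ≤ Real.log n := Real.log_natCast_nonneg n
  have h1 : v / 2 * Real.log n ≤ ψ ^ 2 * (s * Real.log n) / ρ ^ 2 := by
    have h3 : Real.log n ≤ s * Real.log n := le_mul_of_one_le_left hlog0 hs'
    have h4 : v / 2 * Real.log n ≤ ψ ^ 2 * (s * Real.log n) :=
      mul_le_mul (by linarith) h3 hlog0 (by positivity)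
    refine h4.trans (le_div_self (by positivity) (by positivity) ?_)
    exact pow_le_one₀ hρ.le hρ1.le
  have h2 : r ^ 2 * v * m ≤ 1 / 4 * v * m := by
    have h3 : r ^ 2 ≤ 1 / 4 := by nlinarith
    have hvm : 0 ≤ v * m := by positivity
    nlinarith
  have h5 : v * (5 * 10 ^ 9 * Real.log n) ≤ v * (1 / 4 * m) := by linarith
  have h6 := le_of_mul_le_mul_left h5 hv
  linarith

/-- The finite-dimensional lower bound in the case of at least two columns. -/
lemma EntryBounds.measureReal_exists_lt_le_of_two_le (hB : EntryBounds A P v m₃ m₄ (2 * ψ))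
    (hK : v ^ 2 + m₃ + v * m₃ + m₄ ≤ K) (hK2 : 2 * v ^ 2 ≤ K) (hn : 2 ≤ n) (hs : 1 ≤ s)
    (hρ : 0 < ρ) (hρ1 : ρ < 1) (hψ : 0 < ψ) (hvψ : v ≤ 2 * ψ ^ 2)
    (h₁ : 10 ^ 10 * (1 / τ ^ 2) ≤ (v ^ 2 / K) ^ 2 * v * m)
    (h₂ : 10 ^ 10 * (ψ ^ 2 * (s * Real.log n) / ρ ^ 2) ≤ (v ^ 2 / K) ^ 2 * v * m)
    {T : Type*} [Fintype T] [Nonempty T] (x : T → Fin n → ℝ)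
    (hx : ∀ t, ∑ j, x t j ^ 2 = 1) (hR : ∀ t, ∑ j, |x t j| ≤ 2 * Real.sqrt s / ρ) :
    P.real {ω | ∃ t, ∑ i, ((A ω).mulVec (x t) i) ^ 2 < 1 / τ ^ 2} ≤
      Real.exp (-(m * (v ^ 2 / K) ^ 2)) := by
  have hv := hB.var_pos
  have hKpos : 0 < K := lt_of_lt_of_le (by positivity) hK2
  obtain ⟨r, hr⟩ : ∃ r, r = v ^ 2 / K := ⟨_, rfl⟩
  have hr0 : 0 < r := by rw [hr]; positivity
  have hr2 : r ≤ 1 / 2 := by rw [hr, div_le_iff₀ hKpos]; linarith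
  have hcore := fun M hM hMm c u a hc hcL hu ha => hB.measureReal_exists_sum_sq_lt_le
    (M := M) hK hK2 (by omega) hM hMm x hx hR (c := c) (u := u) (a := a) hc hcL hu ha
  rw [← hr] at h₁ h₂ hcore ⊢
  have hs' : (1 : ℝ) ≤ s := by exact_mod_cast hs
  have hn' : (2 : ℝ) ≤ n := by exact_mod_cast hn
  have hlog2 : 0.69 < Real.log n :=
    (by linarith [Real.log_two_gt_d9] : (0.69 : ℝ) < Real.log 2).trans_le
      (Real.log_le_log (by norm_num) hn')
  have hl2 : Real.log (2 * n) ≤ 2 * Real.log n := by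
    rw [Real.log_mul (by norm_num) (by linarith), two_mul]
    exact add_le_add (Real.log_le_log (by norm_num) hn') le_rfl
  have hmlog := log_le_of_row_count hv hr0 hr2 hρ hρ1 hs hvψ (Nat.cast_nonneg m) h₂
  -- Uses `log n ≥ log 2`, hence the restriction to at least two columns.
  have hm600 : 600 < m := by
    have : (600 : ℝ) < m := by linarith
    exact_mod_cast this
  obtain ⟨M, hM⟩ : ∃ M, M = m / 2 := ⟨_, rfl⟩
  have hM0 : 0 < M := by omega
  have hMm : M * 2 ≤ m := by omega
  have hMge : (m : ℝ) ≤ 2 * M + 1 := by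
    have : m ≤ 2 * M + 1 := by omega
    exact_mod_cast this
  have hM300 : (300 : ℝ) ≤ M := by
    have : 300 ≤ M := by omega
    exact_mod_cast this
  have hMpos : (0 : ℝ) < M := by linarith
  obtain ⟨hc, hcL, hbound⟩ := uniform_bound_parameters (s := s) (L := 2 * ψ) (m := m)
    hn hv hr0 hr2 hρ hs' hψ rfl rfl hM0 (by linarith) (by linarith) h₂
  have hfin := hcore M hM0 hMm _ (1.05 * r) (0.02 * r * M) hc hcL (by positivity)
    (by positivity) hbound
  refine (measureReal_mono ?_).trans (hfin.trans (Real.exp_le_exp.2 ?_))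
  · rintro ω ⟨t, ht⟩
    refine ⟨t, lt_of_lt_of_le ht ?_⟩
    have e : v / 100 * (0.02 * r * M) ^ 2 / M = 0.000004 * (r ^ 2 * v * M) := by
      field_simp; norm_num
    rw [e]
    have h1 : r ^ 2 * v * m ≤ r ^ 2 * v * (3 * M) :=
      mul_le_mul_of_nonneg_left (by linarith) (by positivity)
    have h2 : 0 ≤ r ^ 2 * v * M := by positivity
    linarith
  · have h1 : 0 < r ^ 2 := by positivity
    -- `2 · 1.05^2 = 2.205`; the excess over two absorbs a possible unpaired row because `M ≥ 300`.
    -- This is the gain from pairing.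
    have h2 : (m : ℝ) ≤ 2.205 * M := by linarith
    have h3 := mul_le_mul_of_nonneg_right h2 h1.le
    linarith

/-- The robust null space property in terms of bounds on the entries. -/
lemma EntryBounds.measureReal_satisfiesRNSP (hB : EntryBounds A P v m₃ m₄ (2 * ψ))
    (hK : v ^ 2 + m₃ + v * m₃ + m₄ ≤ K) (hK2 : 2 * v ^ 2 ≤ K) (hs : 1 ≤ s) (hsn : s ≤ n)
    (hρ : 0 < ρ) (hρ1 : ρ < 1) (hτ : 0 < τ) (hψ : 0 < ψ) (hvψ : v ≤ 2 * ψ ^ 2)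
    (h₁ : 10 ^ 10 * (1 / τ ^ 2) ≤ (v ^ 2 / K) ^ 2 * v * m)
    (h₂ : 10 ^ 10 * (ψ ^ 2 * (s * Real.log n) / ρ ^ 2) ≤ (v ^ 2 / K) ^ 2 * v * m) :
    1 - Real.exp (-(m * (v ^ 2 / K) ^ 2)) ≤ P.real {ω | SatisfiesRNSP (A ω) s ρ τ} := by
  have hmain : 1 - Real.exp (-(m * (v ^ 2 / K) ^ 2)) ≤ P.real {ω | ∀ x : {x : Fin n → ℝ //
      ∑ j, x j ^ 2 = 1 ∧ ∑ j, |x j| ≤ 2 * Real.sqrt s / ρ},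
      1 / τ ^ 2 ≤ ∑ i, ((A ω).mulVec x.1 i) ^ 2} := by
    refine measureReal_forall_of_finite (E := {x : Fin n → ℝ //
      ∑ j, x j ^ 2 = 1 ∧ ∑ j, |x j| ≤ 2 * Real.sqrt s / ρ})
      (g := fun ω x => ∑ i, ((A ω).mulVec x.1 i) ^ 2) (θ := 1 / τ ^ 2)
      (p := Real.exp (-(m * (v ^ 2 / K) ^ 2))) (fun ω => ?_) (fun x => ?_) (Real.exp_pos _).le fun N x => ?_
    · refine continuous_finsetSum _ fun i _ => Continuous.pow ?_ 2
      exact continuous_finsetSum Finset.univ fun j _ =>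
        continuous_const.mul ((continuous_apply j).comp continuous_subtype_val)
    · exact Finset.measurable_sum _ fun i _ => (hB.measurable_mulVec x.1 i).pow_const 2
    · rcases (hs.trans hsn).eq_or_lt with hn | hn
      · exact hB.measureReal_exists_lt_le_of_eq_one hK hK2 hn.symm h₁ (fun t => (x t).1)
          fun t => (x t).2.1
      · exact hB.measureReal_exists_lt_le_of_two_le hK hK2 hn hs hρ hρ1 hψ hvψ h₁ h₂
          (fun t => (x t).1) (fun t => (x t).2.1) fun t => (x t).2.2
  refine hmain.trans (measureReal_mono fun ω hω => ?_)
  exact satisfiesRNSP_of_lower_bound hs hρ hρ1 hτ fun x h1 h2 => hω ⟨x, h1, h2⟩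

end MainTheorem

theorem mainTheorem4 :
    ∃ C : ℝ, 0 < C ∧
      ∀ (Ω : Type*) [MeasurableSpace Ω] (P : Measure Ω) [IsProbabilityMeasure P]
        (k : ℕ), (k = 1 ∨ k = 2) →
      ∀ (m n : ℕ) (A : Ω → Matrix (Fin m) (Fin n) ℝ),
        (∀ i j, Measurable fun ω => A ω i j) →
        iIndepFun (fun (e : Fin m × Fin n) (ω : Ω) => A ω e.1 e.2) P →
        (∀ i j, HasFinitePsiNorm k (fun ω => A ω i j) P) →
        IsCentral 2 A P →
        0 < matrixCentralMoment 2 A P →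
      ∀ (s : ℕ) (ρ τ : ℝ), 1 ≤ s → s ≤ n → 0 < ρ → ρ < 1 → 0 < τ →
        C * (momentK A P / (matrixCentralMoment 2 A P ^ (5 / 2 : ℝ) * τ) *
            (1 + τ * ρ⁻¹ * matrixPsiNorm k A P * Real.sqrt (s * Real.log n))) ^ 2 ≤ (m : ℝ) →
        1 - Real.exp (-(matrixCentralMoment 2 A P ^ 4 / momentK A P ^ 2 * m)) ≤
          P.real {ω | SatisfiesRNSP (A ω) s ρ τ} := by
  refine ⟨10 ^ 10, by norm_num, ?_⟩
  intro Ω _ P _ k hk m n A hA hind hpsi hcen hvar s ρ τ hs hsn hρ hρ1 hτ hm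
  obtain ⟨i₀, j₀⟩ := nonempty_of_matrixCentralMoment_pos hvar
  have hm₃ : 0 ≤ matrixCentralMoment 3 A P :=
    (abs_nonneg _).trans (abs_centralMoment_le_matrixCentralMoment 3 i₀ j₀)
  have hψ0 : 0 ≤ matrixPsiNorm k A P :=
    Real.iSup_nonneg fun e => Real.sInf_nonneg fun t ht => ht.1.le
  have hE := fun L hL => entryBounds_of_psiNorm hk hA hind hpsi hcen hvar
    (L := L) (hψ0.trans_lt hL) hL
  have hm₄ := (hE (matrixPsiNorm k A P + 1) (lt_add_one _)).sq_var_le i₀ j₀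
  -- The bound `v ≤ 2 L^2` holds for each `L` above the norm; letting `L` decrease to it gives the
  -- claim.
  have hvψ : matrixCentralMoment 2 A P ≤ 2 * matrixPsiNorm k A P ^ 2 := by
    have hcont : Continuous fun L : ℝ => 2 * L ^ 2 := by fun_prop
    have hlim : Filter.Tendsto (fun L : ℝ => 2 * L ^ 2)
        (nhdsWithin (matrixPsiNorm k A P) (Set.Ioi (matrixPsiNorm k A P)))
        (nhds (2 * matrixPsiNorm k A P ^ 2)) :=
      hcont.continuousAt.tendsto.mono_left nhdsWithin_le_nhds
    refine ge_of_tendsto hlim ?_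
    filter_upwards [self_mem_nhdsWithin] with L hL
    exact (hE L hL).var_le i₀ j₀
  have hψ : 0 < matrixPsiNorm k A P := by
    rcases hψ0.eq_or_lt with h | h
    · rw [← h] at hvψ; linarith
    · exact h
  have hK2 : 2 * matrixCentralMoment 2 A P ^ 2 ≤ momentK A P := by
    rw [momentK]
    linarith [mul_nonneg hvar.le hm₃]
  have hKpos : 0 < momentK A P := lt_of_lt_of_le (by positivity) hK2
  have hlog0 : 0 ≤ Real.log n := Real.log_natCast_nonneg n
  obtain ⟨h₁, h₂⟩ := row_count_consequences hvar hKpos hτ hρ hψ0 (by positivity) hm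
  -- Positivity of the norm makes twice its value a strictly larger scale, at the cost of a constant
  -- only.
  have hB := hE (2 * matrixPsiNorm k A P) (by linarith)
  have e : matrixCentralMoment 2 A P ^ 4 / momentK A P ^ 2 * m
      = m * (matrixCentralMoment 2 A P ^ 2 / momentK A P) ^ 2 := by
    rw [div_pow]; ring
  rw [e]
  exact hB.measureReal_satisfiesRNSP (le_of_eq rfl) hK2 hs hsn hρ hρ1 hτ hψ hvψ h₁ h₂
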